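/- Let $N\ge 1$, let $\Omega\subseteq\mathbb{R}^N$ be a bounded open set (no regularity of $\partial\Omega$ is assumed), and let $1<p<\infty$. All functions are real-valued. For $1<s<\infty$, $W^{1,s}(\Omega)$ denotes the space of (a.e. classes of) functions $u\in L^s(\Omega)$ with weak gradient $\nabla u\in L^s(\Omega;\mathbb{R}^N)$, normed by $\left(\int_\Omega|u|^s\,dx+\int_\Omega|\nabla u|^s\,dx\right)^{1/s}$, and $W^{1,s}_0(\Omega)$ denotes the closure of $C_c^\infty(\Omega)$ in $W^{1,s}(\Omega)$. Set $$W^{1,p_-}_0(\Omega)=W^{1,p}(\Omega)\cap\bigcap_{1<s<p}W^{1,s}_0(\Omega).$$ Then the following facts hold. (a) $W^{1,p_-}_0(\Omega)$ is a closed vector subspace of $W^{1,p}(\Omega)$, and $W^{1,p}_0(\Omega)\subseteq W^{1,p_-}_0(\Omega)$. (b) For every $u\in W^{1,p_-}_0(\Omega)$, the function $\hat u$ that equals $u$ on $\Omega$ and $0$ on $\mathbb{R}^N\setminus\Omega$ belongs to $W^{1,p}(\mathbb{R}^N)$; moreover $\left(\int_\Omega|\nabla u|^p\,dx\right)^{1/p}$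 is a norm on $W^{1,p_-}_0(\Omega)$ equivalent to the one induced by $W^{1,p}(\Omega)$. (c) If $p<N$ and $p^*=\frac{Np}{N-p}$, then $W^{1,p_-}_0(\Omega)\subseteq L^{p^*}(\Omega)$ and $$\inf\left\{\frac{\int_\Omega|\nabla u|^p\,dx}{\left(\int_\Omega|u|^{p^*}\,dx\right)^{p/p^*}}:\ u\in W^{1,p}_0(\Omega)\setminus\{0\}\right\}=\inf\left\{\frac{\int_\Omega|\nabla u|^p\,dx}{\left(\int_\Omega|u|^{p^*}\,dx\right)^{p/p^*}}:\ u\in W^{1,p_-}_0(\Omega)\setminus\{0\}\right\}.$$ (The infimum of the empty set is $+\infty$.) (d) If $p>N$, then $W^{1,p_-}_0(\Omega)=W^{1,p}_0(\Omega)$. (e) If $\Omega$ has the segment property (every $x\in\partial\Omega$ has an open neighbourhood $U$ and a vector $y\in\mathbb{R}^N\setminus\{0\}$ such that $z+ty\in\Omega$ for all $z\in\overline\Omega\cap U$ and $0<t<1$), then $W^{1,p_-}_0(\Omega)=W^{1,p}_0(\Omega)$, for any $p\in(1,\infty)$. -/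

import Mathlib

open MeasureTheory Set Filter Topology
open scoped ContDiff

/-- `g` is the weak (distributional) gradient of `u` in the open set `Ω ⊆ ℝ^N`: both are locally
integrable in `Ω` and `∫_Ω u ∂ᵢφ dx = - ∫_Ω gᵢ φ dx` for every `φ ∈ C_c^∞(Ω)` and every `i`. -/
def HasWeakGradient {N : ℕ} (Ω : Set (EuclideanSpace ℝ (Fin N)))
    (u : EuclideanSpace ℝ (Fin N) → ℝ)
    (g : EuclideanSpace ℝ (Fin N) → EuclideanSpace ℝ (Fin N)) : Prop :=
  LocallyIntegrableOn u Ω volume ∧ LocallyIntegrableOn g Ω volume ∧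
    ∀ φ : EuclideanSpace ℝ (Fin N) → ℝ,
      ContDiff ℝ ∞ φ → HasCompactSupport φ → tsupport φ ⊆ Ω →
      ∀ i : Fin N,
        ∫ x in Ω, u x * fderiv ℝ φ x (EuclideanSpace.single i 1) = - ∫ x in Ω, g x i * φ x

open Classical in
/-- The weak gradient of `u` in `Ω`. On an open set it is unique up to null sets when it exists;
the value is `0` when there is none. -/
noncomputable def weakGradient {N : ℕ} (Ω : Set (EuclideanSpace ℝ (Fin N)))
    (u : EuclideanSpace ℝ (Fin N) → ℝ) : EuclideanSpace ℝ (Fin N) → EuclideanSpace ℝ (Fin N) :=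
  if h : ∃ g, HasWeakGradient Ω u g then h.choose else 0

/-- The function `u` represents an element of `W^{1,p}(Ω)`: it is in `L^p(Ω)` and has a weak
gradient in `Ω` that is in `L^p(Ω; ℝ^N)`. -/
def MemSobolev {N : ℕ} (Ω : Set (EuclideanSpace ℝ (Fin N))) (p : ℝ)
    (u : EuclideanSpace ℝ (Fin N) → ℝ) : Prop :=
  MemLp u (ENNReal.ofReal p) (volume.restrict Ω) ∧
    ∃ g, HasWeakGradient Ω u g ∧ MemLp g (ENNReal.ofReal p) (volume.restrict Ω)

/-- The real vector space of (almost everywhere classes of) measurable functions on `Ω`, in which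
all the spaces `W^{1,p}(Ω)`, for all `p`, are contained. -/
abbrev MeasFun {N : ℕ} (Ω : Set (EuclideanSpace ℝ (Fin N))) : Type :=
  EuclideanSpace ℝ (Fin N) →ₘ[volume.restrict Ω] ℝ

/-- The Sobolev space `W^{1,p}(Ω)`. -/
def SobolevW {N : ℕ} (Ω : Set (EuclideanSpace ℝ (Fin N))) (p : ℝ) : Set (MeasFun Ω) :=
  {u | MemSobolev Ω p u}

/-- `(∫_Ω |∇u|^p dx)^{1/p}`. -/
noncomputable def gradNorm {N : ℕ} (Ω : Set (EuclideanSpace ℝ (Fin N))) (p : ℝ)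
    (u : MeasFun Ω) : ℝ :=
  (∫ x in Ω, ‖weakGradient Ω u x‖ ^ p) ^ (1 / p)

/-- The norm `(∫_Ω |u|^p dx + ∫_Ω |∇u|^p dx)^{1/p}` of `W^{1,p}(Ω)`. -/
noncomputable def sobolevNorm {N : ℕ} (Ω : Set (EuclideanSpace ℝ (Fin N))) (p : ℝ)
    (u : MeasFun Ω) : ℝ :=
  ((∫ x in Ω, |u x| ^ p) + ∫ x in Ω, ‖weakGradient Ω u x‖ ^ p) ^ (1 / p)

/-- The closure of `S` in the normed space `W^{1,p}(Ω)`. -/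
def sobolevClosure {N : ℕ} (Ω : Set (EuclideanSpace ℝ (Fin N))) (p : ℝ)
    (S : Set (MeasFun Ω)) : Set (MeasFun Ω) :=
  {u | u ∈ SobolevW Ω p ∧ ∀ ε > 0, ∃ v ∈ S, sobolevNorm Ω p (u - v) < ε}

/-- `C_c^∞(Ω)`, as a set of classes of functions on `Ω`. -/
def testFunctions {N : ℕ} (Ω : Set (EuclideanSpace ℝ (Fin N))) : Set (MeasFun Ω) :=
  {u | ∃ φ : EuclideanSpace ℝ (Fin N) → ℝ,
    ContDiff ℝ ∞ φ ∧ HasCompactSupport φ ∧ tsupport φ ⊆ Ω ∧ u =ᵐ[volume.restrict Ω] φ}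

/-- `W^{1,p}_0(Ω)`, the closure of `C_c^∞(Ω)` in `W^{1,p}(Ω)`. -/
def SobolevWZero {N : ℕ} (Ω : Set (EuclideanSpace ℝ (Fin N))) (p : ℝ) : Set (MeasFun Ω) :=
  sobolevClosure Ω p (testFunctions Ω)

/-- `W^{1,p_-}_0(Ω) = W^{1,p}(Ω) ∩ ⋂_{1<s<p} W^{1,s}_0(Ω)`. -/
def SobolevWZeroMinus {N : ℕ} (Ω : Set (EuclideanSpace ℝ (Fin N))) (p : ℝ) : Set (MeasFun Ω) :=
  SobolevW Ω p ∩ ⋂ s ∈ Ioo 1 p, SobolevWZero Ω s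

/-- `n` is a norm on (the linear subspace with underlying set) `V`. -/
def IsNormOn {X : Type*} [AddCommGroup X] [Module ℝ X] (V : Set X) (n : X → ℝ) : Prop :=
  (∀ u ∈ V, 0 ≤ n u) ∧ (∀ u ∈ V, n u = 0 ↔ u = 0) ∧
    (∀ (c : ℝ), ∀ u ∈ V, n (c • u) = |c| * n u) ∧
    ∀ u ∈ V, ∀ v ∈ V, n (u + v) ≤ n u + n v

/-- The critical exponent `p^* = N p / (N - p)` (for `p < N`). -/
noncomputable def criticalExponent (N : ℕ) (p : ℝ) : ℝ := N * p / (N - p)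

/-- The Sobolev quotient `∫_Ω |∇u|^p dx / (∫_Ω |u|^{p^*} dx)^{p/p^*}`. -/
noncomputable def sobolevQuotient {N : ℕ} (Ω : Set (EuclideanSpace ℝ (Fin N))) (p : ℝ)
    (u : MeasFun Ω) : ℝ :=
  (∫ x in Ω, ‖weakGradient Ω u x‖ ^ p) /
    (∫ x in Ω, |u x| ^ criticalExponent N p) ^ (p / criticalExponent N p)

/-- The segment property: every boundary point has an open neighbourhood `U` and a nonzero
vector `y` such that `z + t y ∈ Ω` whenever `z ∈ closure Ω ∩ U` and `0 < t < 1`. -/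
def SegmentProperty {N : ℕ} (Ω : Set (EuclideanSpace ℝ (Fin N))) : Prop :=
  ∀ x ∈ frontier Ω, ∃ U : Set (EuclideanSpace ℝ (Fin N)), IsOpen U ∧ x ∈ U ∧
    ∃ y : EuclideanSpace ℝ (Fin N), y ≠ 0 ∧
      ∀ z ∈ closure Ω ∩ U, ∀ t ∈ Ioo (0 : ℝ) 1, z + t • y ∈ Ω

/-! Everything rests on the extension by zero. Let `u` be in the space and `g` its weak gradient in
`Ω`. For one exponent `s < p`, test functions of `Ω` converge to the extension of `u` in `L^s(ℝ^N)`,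
and their gradients to the extension of `g`. Weak gradients pass to `L^s` limits, so the extended
`g` is the weak gradient of the extended `u` on all of `ℝ^N`. Integrability at the full exponent `p`
is free, since `u ∈ W^{1,p}(Ω)`. This is `IsSobolevPair.extend`.

The extension is in `W^{1,p}(ℝ^N)` with support in the compact set `closure Ω`, so mollification
approximates it at exponent `p` by test functions of any neighbourhood of `closure Ω`
(`IsSobolevPair.approxByTest_extend`). These need not be supported in `Ω`, which is the gap between
the two spaces. They still suffice for the Poincaré and Sobolev inequalities, whose constants do not
see `Ω` beyond a ball containing it. In (c) the Sobolev quotient of a test function of `ℝ^N` is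
invariant under translation and dilation, so the function can be moved into `Ω`
(`IsTest.exists_rescale`).

In (d) and (e) the approximants must be brought into `Ω`. If `p > N`, some `s` lies strictly between
`N` and `p`; Morrey's bound in `W_0^{1,s}` gives a continuous representative vanishing off `Ω`.
Truncating its small values leaves compact support in `Ω`, and mollification applies
(`HasWeakGradient.approxByTest_of_continuous`). Under the segment property, a partition of unity
localises the function, and each piece is translated into `Ω` before mollifying
(`HasWeakGradient.approxByTest_of_segmentProperty`).

Part (a) is Hölder's inequality on the bounded set `Ω`: convergence in `W^{1,p}` implies convergence
in `W^{1,s}`. Throughout, membership in `W_0^{1,s}` is rephrased as `ApproxByTest`, a statement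
about functions on `ℝ^N`. -/

open scoped ENNReal

/-- The Euclidean space `ℝ^N`. -/
abbrev Eu (N : ℕ) : Type := EuclideanSpace ℝ (Fin N)

/-- `φ ∈ C_c^∞(Ω)`. -/
structure IsTest {N : ℕ} (Ω : Set (Eu N)) (φ : Eu N → ℝ) : Prop where
  contDiff : ContDiff ℝ ∞ φ
  hasCompactSupport : HasCompactSupport φ
  tsupport_subset : tsupport φ ⊆ Ω

/-! ### Classical gradients and test functions -/

section gradient

variable {N : ℕ}

lemma gradient_apply_eq (φ : Eu N → ℝ) (x : Eu N) (i : Fin N) :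
    gradient φ x i = fderiv ℝ φ x (EuclideanSpace.single i 1) := by
  have h := InnerProductSpace.toDual_symm_apply (𝕜 := ℝ) (x := EuclideanSpace.single i (1 : ℝ))
    (y := fderiv ℝ φ x)
  rw [← h, EuclideanSpace.inner_single_right]
  simp [gradient]

lemma norm_gradient (φ : Eu N → ℝ) (x : Eu N) : ‖gradient φ x‖ = ‖fderiv ℝ φ x‖ := by
  simp [gradient]

lemma continuous_gradient {φ : Eu N → ℝ} (h : ContDiff ℝ 1 φ) : Continuous (gradient φ) :=
  (LinearIsometryEquiv.continuous _).comp (h.continuous_fderiv (by simp))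

lemma gradient_eq_zero_of_notMem_tsupport {φ : Eu N → ℝ} {x : Eu N} (h : x ∉ tsupport φ) :
    gradient φ x = 0 := by
  have : fderiv ℝ φ x = 0 := by
    by_contra h'
    exact h (support_fderiv_subset ℝ h')
  simp [gradient, this]

lemma hasCompactSupport_gradient {φ : Eu N → ℝ} (h : HasCompactSupport φ) :
    HasCompactSupport (gradient φ) := by
  refine HasCompactSupport.intro h fun x hx => gradient_eq_zero_of_notMem_tsupport hx

lemma gradient_add {φ ψ : Eu N → ℝ} (hφ : Differentiable ℝ φ) (hψ : Differentiable ℝ ψ) :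
    gradient (φ + ψ) = gradient φ + gradient ψ := by
  ext1 x
  simp [gradient, fderiv_add (hφ x) (hψ x)]

lemma gradient_sub {φ ψ : Eu N → ℝ} (hφ : Differentiable ℝ φ) (hψ : Differentiable ℝ ψ) :
    gradient (φ - ψ) = gradient φ - gradient ψ := by
  ext1 x
  simp [gradient, fderiv_sub (hφ x) (hψ x)]

lemma gradient_const_smul {φ : Eu N → ℝ} (c : ℝ) (hφ : Differentiable ℝ φ) :
    gradient (c • φ) = c • gradient φ := by
  ext1 x
  simp [gradient, fderiv_const_smul (hφ x)]

lemma gradient_zero : gradient (0 : Eu N → ℝ) = 0 := by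
  ext1 x
  simp [gradient]

end gradient

namespace IsTest

variable {N : ℕ} {Ω : Set (Eu N)} {φ ψ : Eu N → ℝ}

lemma contDiff_one (h : IsTest Ω φ) : ContDiff ℝ 1 φ := h.contDiff.of_le (by simp)

lemma differentiable (h : IsTest Ω φ) : Differentiable ℝ φ := h.contDiff_one.differentiable (by simp)

lemma continuous (h : IsTest Ω φ) : Continuous φ := h.contDiff.continuous

lemma add (hφ : IsTest Ω φ) (hψ : IsTest Ω ψ) : IsTest Ω (φ + ψ) where
  contDiff := hφ.contDiff.add hψ.contDiff
  hasCompactSupport := hφ.hasCompactSupport.add hψ.hasCompactSupport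
  tsupport_subset := (tsupport_add φ ψ).trans (union_subset hφ.tsupport_subset hψ.tsupport_subset)

lemma const_smul (c : ℝ) (hφ : IsTest Ω φ) : IsTest Ω (c • φ) where
  contDiff := hφ.contDiff.const_smul c
  hasCompactSupport := hφ.hasCompactSupport.mono (Function.support_const_smul_subset c φ)
  tsupport_subset := (closure_mono (Function.support_const_smul_subset c φ)).trans
    hφ.tsupport_subset

lemma zero : IsTest Ω (0 : Eu N → ℝ) where
  contDiff := contDiff_const
  hasCompactSupport := HasCompactSupport.zero
  tsupport_subset := by simp

lemma mono {Ω' : Set (Eu N)} (hφ : IsTest Ω φ) (h : Ω ⊆ Ω') : IsTest Ω' φ :=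
  ⟨hφ.contDiff, hφ.hasCompactSupport, hφ.tsupport_subset.trans h⟩

lemma memLp (hφ : IsTest Ω φ) (p : ℝ≥0∞) (μ : Measure (Eu N)) [IsFiniteMeasureOnCompacts μ] :
    MemLp φ p μ := hφ.continuous.memLp_of_hasCompactSupport hφ.hasCompactSupport

lemma memLp_gradient (hφ : IsTest Ω φ) (p : ℝ≥0∞) (μ : Measure (Eu N))
    [IsFiniteMeasureOnCompacts μ] : MemLp (gradient φ) p μ :=
  (continuous_gradient hφ.contDiff_one).memLp_of_hasCompactSupport
    (hasCompactSupport_gradient hφ.hasCompactSupport)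

lemma partial_continuous (hφ : IsTest Ω φ) (i : Fin N) :
    Continuous fun x => fderiv ℝ φ x (EuclideanSpace.single i 1) :=
  (hφ.contDiff_one.continuous_fderiv (by simp)).clm_apply continuous_const

lemma partial_hasCompactSupport (hφ : IsTest Ω φ) (i : Fin N) :
    HasCompactSupport fun x => fderiv ℝ φ x (EuclideanSpace.single i 1) :=
  hφ.hasCompactSupport.fderiv_apply (𝕜 := ℝ) _

lemma partial_tsupport (hφ : IsTest Ω φ) (i : Fin N) :
    tsupport (fun x => fderiv ℝ φ x (EuclideanSpace.single i 1)) ⊆ Ω :=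
  (tsupport_fderiv_apply_subset ℝ _).trans hφ.tsupport_subset

lemma eq_zero (hφ : IsTest Ω φ) {x : Eu N} (hx : x ∉ Ω) : φ x = 0 :=
  image_eq_zero_of_notMem_tsupport fun h => hx (hφ.tsupport_subset h)

lemma gradient_eq_zero (hφ : IsTest Ω φ) {x : Eu N} (hx : x ∉ Ω) : gradient φ x = 0 :=
  gradient_eq_zero_of_notMem_tsupport fun h => hx (hφ.tsupport_subset h)

end IsTest

/-! ### Integrability against test functions -/

section integrability

variable {N : ℕ} {Ω : Set (Eu N)}

lemma integrable_smul_of_tsupport_subset {F : Type*} [NormedAddCommGroup F] [NormedSpace ℝ F]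
    {u : Eu N → F} (hu : LocallyIntegrableOn u Ω volume) {φ : Eu N → ℝ} (hφ : Continuous φ)
    (hc : HasCompactSupport φ) (hs : tsupport φ ⊆ Ω) :
    Integrable (fun x => φ x • u x) volume := by
  have h1 : IntegrableOn u (tsupport φ) volume := hu.integrableOn_compact_subset hs hc
  have h2 : IntegrableOn (fun x => φ x • u x) (tsupport φ) volume :=
    h1.continuousOn_smul hφ.continuousOn hc
  refine (integrableOn_iff_integrable_of_support_subset ?_).1 h2
  intro x hx
  refine subset_tsupport φ fun h => hx ?_
  simp [h]

lemma integrable_mul_of_tsupport_subset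
    {u : Eu N → ℝ} (hu : LocallyIntegrableOn u Ω volume) {φ : Eu N → ℝ} (hφ : Continuous φ)
    (hc : HasCompactSupport φ) (hs : tsupport φ ⊆ Ω) :
    Integrable (fun x => u x * φ x) volume := by
  simpa [mul_comm] using integrable_smul_of_tsupport_subset hu hφ hc hs

lemma integrable_coord_mul_of_tsupport_subset
    {g : Eu N → Eu N} (hu : LocallyIntegrableOn g Ω volume) {φ : Eu N → ℝ} (hφ : Continuous φ)
    (hc : HasCompactSupport φ) (hs : tsupport φ ⊆ Ω) (i : Fin N) :
    Integrable (fun x => g x i * φ x) volume := by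
  have h := (EuclideanSpace.proj i : Eu N →L[ℝ] ℝ).integrable_comp
    (integrable_smul_of_tsupport_subset hu hφ hc hs)
  simpa [mul_comm] using h

lemma setIntegral_mul_eq {F : Eu N → ℝ} {φ : Eu N → ℝ} (hs : tsupport φ ⊆ Ω) :
    ∫ x in Ω, F x * φ x = ∫ x, F x * φ x := by
  refine setIntegral_eq_integral_of_forall_compl_eq_zero fun x hx => ?_
  rw [image_eq_zero_of_notMem_tsupport fun h => hx (hs h), mul_zero]

lemma MeasureTheory.MemLp.locallyIntegrableOn {F : Type*} [NormedAddCommGroup F]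
    {u : Eu N → F} {p : ℝ≥0∞} (hp : 1 ≤ p) (hu : MemLp u p (volume.restrict Ω)) :
    LocallyIntegrableOn u Ω volume := by
  intro x hx
  obtain ⟨K, hK, hxK⟩ := exists_compact_mem_nhds x
  refine ⟨K ∩ Ω, mem_nhdsWithin.2 ⟨interior K, isOpen_interior, mem_interior_iff_mem_nhds.2 hxK,
    fun y hy => ⟨interior_subset hy.1, hy.2⟩⟩, ?_⟩
  rw [IntegrableOn, ← Measure.restrict_restrict hK.measurableSet]
  have : IsFiniteMeasure ((volume.restrict Ω).restrict K) :=
    ⟨by rw [Measure.restrict_apply_univ]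
        exact (Measure.restrict_apply_le _ _).trans_lt hK.measure_lt_top⟩
  exact (hu.restrict K).integrable hp

lemma enorm_integral_mul_le {α : Type*} [MeasurableSpace α] {μ : Measure α} {p q : ℝ≥0∞}
    [ENNReal.HolderConjugate p q] {f h : α → ℝ} (hf : AEStronglyMeasurable f μ)
    (hh : AEStronglyMeasurable h μ) :
    ‖∫ x, f x * h x ∂μ‖ₑ ≤ eLpNorm f p μ * eLpNorm h q μ := by
  calc ‖∫ x, f x * h x ∂μ‖ₑ ≤ ∫⁻ x, ‖f x * h x‖ₑ ∂μ := enorm_integral_le_lintegral_enorm _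
    _ = eLpNorm (f • h) 1 μ := by rw [eLpNorm_one_eq_lintegral_enorm]; rfl
    _ ≤ _ := eLpNorm_smul_le_mul_eLpNorm (p := p) (q := q) hh hf

lemma eLpNorm_coord_le {α : Type*} [MeasurableSpace α] {μ : Measure α} {p : ℝ≥0∞}
    (g : α → Eu N) (i : Fin N) : eLpNorm (fun x => g x i) p μ ≤ eLpNorm g p μ :=
  eLpNorm_mono fun x => PiLp.norm_apply_le (g x) i

lemma aestronglyMeasurable_coord {α : Type*} [MeasurableSpace α] {μ : Measure α}
    {g : α → Eu N} (hg : AEStronglyMeasurable g μ) (i : Fin N) :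
    AEStronglyMeasurable (fun x => g x i) μ :=
  (EuclideanSpace.proj i : Eu N →L[ℝ] ℝ).continuous.comp_aestronglyMeasurable hg

end integrability

/-! ### Calculus of weak gradients -/

namespace HasWeakGradient

variable {N : ℕ} {Ω : Set (Eu N)} {u v : Eu N → ℝ} {g h : Eu N → Eu N}

lemma integral_eq (hu : HasWeakGradient Ω u g) {φ : Eu N → ℝ} (hφ : IsTest Ω φ) (i : Fin N) :
    ∫ x in Ω, u x * fderiv ℝ φ x (EuclideanSpace.single i 1) = - ∫ x in Ω, g x i * φ x :=
  hu.2.2 φ hφ.contDiff hφ.hasCompactSupport hφ.tsupport_subset i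

lemma integrable_left (hu : HasWeakGradient Ω u g) {φ : Eu N → ℝ} (hφ : IsTest Ω φ) (i : Fin N) :
    Integrable (fun x => u x * fderiv ℝ φ x (EuclideanSpace.single i 1)) (volume.restrict Ω) :=
  (integrable_mul_of_tsupport_subset hu.1 (hφ.partial_continuous i) (hφ.partial_hasCompactSupport i)
    (hφ.partial_tsupport i)).integrableOn

lemma integrable_right (hu : HasWeakGradient Ω u g) {φ : Eu N → ℝ} (hφ : IsTest Ω φ) (i : Fin N) :
    Integrable (fun x => g x i * φ x) (volume.restrict Ω) :=
  (integrable_coord_mul_of_tsupport_subset hu.2.1 hφ.continuous hφ.hasCompactSupport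
    hφ.tsupport_subset i).integrableOn

/-- The difference of two candidates integrates to zero against every test function; the fundamental
lemma of the calculus of variations, applied to each coordinate, makes it vanish. -/
lemma ae_unique (hΩ : IsOpen Ω) (hg : HasWeakGradient Ω u g) (hh : HasWeakGradient Ω u h) :
    g =ᵐ[volume.restrict Ω] h := by
  have key : ∀ i : Fin N, ∀ᵐ x ∂(volume : Measure (Eu N)), x ∈ Ω → g x i - h x i = 0 := by
    intro i
    have hloc : LocallyIntegrableOn (fun x => g x i - h x i) Ω volume := by
      have h0 := hg.2.1.sub hh.2.1
      intro x hx
      obtain ⟨t, ht, hi⟩ := h0 x hx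
      refine ⟨t, ht, ?_⟩
      simpa using! (EuclideanSpace.proj i : Eu N →L[ℝ] ℝ).integrable_comp hi
    refine hΩ.ae_eq_zero_of_integral_contDiff_smul_eq_zero hloc fun φ h1 h2 h3 => ?_
    have hφ : IsTest Ω φ := ⟨h1, h2, h3⟩
    have e1 := hg.integral_eq hφ i
    have e2 := hh.integral_eq hφ i
    rw [e1, neg_inj] at e2
    have e3 := integral_sub (hg.integrable_right hφ i) (hh.integrable_right hφ i)
    rw [e2, sub_self] at e3
    rw [← e3]
    simp_rw [← sub_mul]
    rw [setIntegral_mul_eq h3]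
    simp [mul_comm]
  rw [EventuallyEq, ae_restrict_iff' hΩ.measurableSet]
  filter_upwards [eventually_all.2 key] with x hx hxΩ
  ext i
  linarith [hx i hxΩ]

lemma congr_ae (hu : HasWeakGradient Ω u g) (huv : u =ᵐ[volume.restrict Ω] v)
    (hgh : g =ᵐ[volume.restrict Ω] h) : HasWeakGradient Ω v h := by
  have aux : ∀ {F : Type} [NormedAddCommGroup F] {a b : Eu N → F},
      LocallyIntegrableOn a Ω volume → a =ᵐ[volume.restrict Ω] b →
      LocallyIntegrableOn b Ω volume := by
    intro F _ a b ha hab x hx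
    obtain ⟨t, ht, hi⟩ := ha x hx
    refine ⟨t ∩ Ω, inter_mem ht self_mem_nhdsWithin, ?_⟩
    exact (hi.mono_set inter_subset_left).congr_fun_ae
      (ae_restrict_of_ae_restrict_of_subset inter_subset_right hab)
  refine ⟨aux hu.1 huv, aux hu.2.1 hgh, fun φ h1 h2 h3 i => ?_⟩
  have e := hu.integral_eq ⟨h1, h2, h3⟩ i
  have e1 : ∫ x in Ω, u x * fderiv ℝ φ x (EuclideanSpace.single i 1) =
      ∫ x in Ω, v x * fderiv ℝ φ x (EuclideanSpace.single i 1) :=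
    integral_congr_ae (by filter_upwards [huv] with x hx; rw [hx])
  have e2 : ∫ x in Ω, g x i * φ x = ∫ x in Ω, h x i * φ x :=
    integral_congr_ae (by filter_upwards [hgh] with x hx; rw [hx])
  rw [← e1, ← e2, e]

/-- Removes the arbitrary choice in `weakGradient`: integrals involving it can be computed with any
known weak gradient. -/
lemma weakGradient_ae_eq (hΩ : IsOpen Ω) (hu : HasWeakGradient Ω u g) :
    weakGradient Ω u =ᵐ[volume.restrict Ω] g := by
  have hex : ∃ g, HasWeakGradient Ω u g := ⟨g, hu⟩
  have : HasWeakGradient Ω u (weakGradient Ω u) := by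
    rw [weakGradient, dif_pos hex]
    exact hex.choose_spec
  exact this.ae_unique hΩ hu

lemma add (hu : HasWeakGradient Ω u g) (hv : HasWeakGradient Ω v h) :
    HasWeakGradient Ω (u + v) (g + h) := by
  refine ⟨hu.1.add hv.1, hu.2.1.add hv.2.1, fun φ h1 h2 h3 i => ?_⟩
  have hφ : IsTest Ω φ := ⟨h1, h2, h3⟩
  simp only [Pi.add_apply, PiLp.add_apply, add_mul]
  rw [integral_add (hu.integrable_left hφ i) (hv.integrable_left hφ i),
    integral_add (hu.integrable_right hφ i) (hv.integrable_right hφ i),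
    hu.integral_eq hφ, hv.integral_eq hφ]
  ring

lemma const_smul (c : ℝ) (hu : HasWeakGradient Ω u g) :
    HasWeakGradient Ω (c • u) (c • g) := by
  refine ⟨hu.1.smul c, hu.2.1.smul c, fun φ h1 h2 h3 i => ?_⟩
  have hφ : IsTest Ω φ := ⟨h1, h2, h3⟩
  simp only [Pi.smul_apply, PiLp.smul_apply, smul_eq_mul, mul_assoc]
  rw [integral_const_mul, integral_const_mul, hu.integral_eq hφ]
  ring

lemma sub (hu : HasWeakGradient Ω u g) (hv : HasWeakGradient Ω v h) :
    HasWeakGradient Ω (u - v) (g - h) := by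
  have := hu.add (hv.const_smul (-1))
  simpa [sub_eq_add_neg] using this

lemma of_contDiff (hu : ContDiff ℝ 1 u) : HasWeakGradient Ω u (gradient u) := by
  have c1 : LocallyIntegrable u (volume : Measure (Eu N)) := hu.continuous.locallyIntegrable
  have c2 : LocallyIntegrable (gradient u) (volume : Measure (Eu N)) :=
    (continuous_gradient hu).locallyIntegrable
  refine ⟨c1.locallyIntegrableOn _, c2.locallyIntegrableOn _, fun φ h1 h2 h3 i => ?_⟩
  have hφ : IsTest Ω φ := ⟨h1, h2, h3⟩
  rw [setIntegral_mul_eq (hφ.partial_tsupport i), setIntegral_mul_eq h3]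
  simp_rw [gradient_apply_eq]
  refine integral_mul_fderiv_eq_neg_fderiv_mul_of_integrable ?_ ?_ ?_ ?_ ?_
  · simp_rw [← gradient_apply_eq]
    exact integrable_coord_mul_of_tsupport_subset (c2.locallyIntegrableOn univ) hφ.continuous h2
      (subset_univ _) i
  · exact integrable_mul_of_tsupport_subset (c1.locallyIntegrableOn univ) (hφ.partial_continuous i)
      (hφ.partial_hasCompactSupport i) (subset_univ _)
  · exact integrable_mul_of_tsupport_subset (c1.locallyIntegrableOn univ) hφ.continuous h2
      (subset_univ _)
  · exact fun x _ => hu.differentiable (by simp) x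
  · exact fun x _ => hφ.differentiable x

/-- Weak gradients pass to the limit in `L^p`. -/
lemma of_approx {p : ℝ≥0∞} (hp : 1 ≤ p) (hu : MemLp u p (volume.restrict Ω))
    (hg : MemLp g p (volume.restrict Ω))
    (H : ∀ ε : ℝ≥0∞, ε ≠ 0 → ∃ v h, HasWeakGradient Ω v h ∧
      AEStronglyMeasurable v (volume.restrict Ω) ∧ AEStronglyMeasurable h (volume.restrict Ω) ∧
      eLpNorm (u - v) p (volume.restrict Ω) ≤ ε ∧ eLpNorm (g - h) p (volume.restrict Ω) ≤ ε) :
    HasWeakGradient Ω u g := by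
  refine ⟨hu.locallyIntegrableOn hp, hg.locallyIntegrableOn hp, fun φ h1 h2 h3 i => ?_⟩
  have hφ : IsTest Ω φ := ⟨h1, h2, h3⟩
  set q := ENNReal.conjExponent p
  have : ENNReal.HolderConjugate p q := .conjExponent hp
  set ψ := fun x => fderiv ℝ φ x (EuclideanSpace.single i 1) with hψ
  have hψm : MemLp ψ q (volume.restrict Ω) :=
    (hφ.partial_continuous i).memLp_of_hasCompactSupport (hφ.partial_hasCompactSupport i)
  have hφm : MemLp φ q (volume.restrict Ω) := hφ.memLp _ _
  have hiu : Integrable (fun x => u x * ψ x) (volume.restrict Ω) :=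
    (integrable_mul_of_tsupport_subset (hu.locallyIntegrableOn hp) (hφ.partial_continuous i)
      (hφ.partial_hasCompactSupport i) (hφ.partial_tsupport i)).integrableOn
  have hig : Integrable (fun x => g x i * φ x) (volume.restrict Ω) :=
    (integrable_coord_mul_of_tsupport_subset (hg.locallyIntegrableOn hp) hφ.continuous
      hφ.hasCompactSupport hφ.tsupport_subset i).integrableOn
  set A := eLpNorm ψ q (volume.restrict Ω)
  set B := eLpNorm φ q (volume.restrict Ω)
  -- `T` is the defect in integration by parts. It is linear in the pair and zero for `(v, h)`, so
  -- it depends only on `(u - v, g - h)`, which Hölder controls.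
  set T := (∫ x in Ω, u x * ψ x) + ∫ x in Ω, g x i * φ x with hT
  have hbound : ∀ ε : ℝ≥0∞, ε ≠ 0 → ‖T‖ₑ ≤ ε * A + ε * B := by
    intro ε hε
    obtain ⟨v, h, hvh, mv, mh, hv, hh⟩ := H ε hε
    have e := hvh.integral_eq hφ i
    have e1 : T = (∫ x in Ω, (u - v) x * ψ x) + ∫ x in Ω, (fun y => (g - h) y i) x * φ x := by
      simp only [Pi.sub_apply, PiLp.sub_apply, sub_mul]
      rw [integral_sub hiu (hvh.integrable_left hφ i), integral_sub hig (hvh.integrable_right hφ i)]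
      rw [hT]
      linarith
    rw [e1]
    refine (enorm_add_le _ _).trans (add_le_add ?_ ?_)
    · refine (enorm_integral_mul_le (p := p) (q := q) (hu.1.sub mv) hψm.1).trans ?_
      gcongr
    · refine (enorm_integral_mul_le (p := p) (q := q)
        (aestronglyMeasurable_coord (hg.1.sub mh) i) hφm.1).trans ?_
      gcongr
      exact (eLpNorm_coord_le _ i).trans hh
  have hT0 : ‖T‖ₑ = 0 := by
    have hlim : Tendsto (fun ε : ℝ≥0∞ => ε * A + ε * B) (𝓝[>] 0) (𝓝 (0 * A + 0 * B)) := by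
      refine Tendsto.mono_left ?_ nhdsWithin_le_nhds
      refine Tendsto.add ?_ ?_
      · exact ENNReal.Tendsto.mul_const tendsto_id (Or.inr hψm.2.ne)
      · exact ENNReal.Tendsto.mul_const tendsto_id (Or.inr hφm.2.ne)
    rw [zero_mul, zero_mul, zero_add] at hlim
    refine le_antisymm (ge_of_tendsto hlim ?_) zero_le
    filter_upwards [self_mem_nhdsWithin] with ε hε using hbound ε (ne_of_gt hε)
  have : T = 0 := by simpa using hT0
  linarith

/-- The product rule for a weakly differentiable and a smooth function. -/
lemma smul_smooth {χ : Eu N → ℝ} (hχ : ContDiff ℝ ∞ χ) (hΩ : IsOpen Ω)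
    (hu : HasWeakGradient Ω u g) :
    HasWeakGradient Ω (fun x => χ x * u x) (fun x => χ x • g x + u x • gradient χ x) := by
  have hgc := continuous_gradient (hχ.of_le (by simp) : ContDiff ℝ 1 χ)
  have l1 : LocallyIntegrableOn (fun x => χ x * u x) Ω volume :=
    hu.1.continuousOn_mul hχ.continuous.continuousOn hΩ.isLocallyClosed
  have l2 : LocallyIntegrableOn (fun x => χ x • g x) Ω volume :=
    hu.2.1.continuousOn_smul hΩ.isLocallyClosed hχ.continuous.continuousOn
  have l3 : LocallyIntegrableOn (fun x => u x • gradient χ x) Ω volume :=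
    hu.1.smul_continuousOn hΩ.isLocallyClosed hgc.continuousOn
  refine ⟨l1, l2.add l3, fun φ h1 h2 h3 i => ?_⟩
  have hφ : IsTest Ω φ := ⟨h1, h2, h3⟩
  -- `χ φ` is again a test function; testing `u` against it and expanding its derivative is the
  -- whole product rule.
  have hχφ : IsTest Ω (fun x => χ x * φ x) :=
    ⟨hχ.mul h1, h2.mul_left, (tsupport_mul_subset_right).trans h3⟩
  have e := hu.integral_eq hχφ i
  have d : ∀ x, fderiv ℝ (fun x => χ x * φ x) x (EuclideanSpace.single i 1) =
      χ x * fderiv ℝ φ x (EuclideanSpace.single i 1) + gradient χ x i * φ x := by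
    intro x
    rw [fderiv_fun_mul (hχ.differentiable (by simp) x) (hφ.differentiable x), gradient_apply_eq]
    simp [mul_comm]
  simp_rw [d, mul_add] at e
  have i1 : Integrable (fun x => u x * (χ x * fderiv ℝ φ x (EuclideanSpace.single i 1)))
      (volume.restrict Ω) := by
    have := (integrable_mul_of_tsupport_subset l1 (hφ.partial_continuous i)
      (hφ.partial_hasCompactSupport i) (hφ.partial_tsupport i)).integrableOn (s := Ω)
    refine this.congr (Eventually.of_forall fun x => ?_)
    simp only []
    ring
  have i2 : Integrable (fun x => u x * (gradient χ x i * φ x)) (volume.restrict Ω) := by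
    have := (integrable_coord_mul_of_tsupport_subset l3 hφ.continuous
      hφ.hasCompactSupport hφ.tsupport_subset i).integrableOn (s := Ω)
    refine this.congr (Eventually.of_forall fun x => ?_)
    simp
    ring
  have i3 : Integrable (fun x => g x i * (χ x * φ x)) (volume.restrict Ω) :=
    hu.integrable_right hχφ i
  rw [integral_add i1 i2] at e
  have e1 : ∫ x in Ω, (χ x • g x + u x • gradient χ x) i * φ x =
      (∫ x in Ω, g x i * (χ x * φ x)) + ∫ x in Ω, u x * (gradient χ x i * φ x) := by
    rw [← integral_add i3 i2]
    congr 1 with x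
    simp
    ring
  have e2 : ∫ x in Ω, χ x * u x * fderiv ℝ φ x (EuclideanSpace.single i 1) =
      ∫ x in Ω, u x * (χ x * fderiv ℝ φ x (EuclideanSpace.single i 1)) := by
    congr 1 with x
    ring
  rw [e1, e2]
  linarith

/-- Translations of weakly differentiable functions on the whole space. -/
lemma comp_sub_right (hu : HasWeakGradient univ u g) (a : Eu N) :
    HasWeakGradient univ (fun x => u (x - a)) (fun x => g (x - a)) := by
  have aux : ∀ {F : Type} [NormedAddCommGroup F] {b : Eu N → F},
      LocallyIntegrableOn b univ volume → LocallyIntegrableOn (fun x => b (x - a)) univ volume := by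
    intro F _ b hb
    rw [locallyIntegrableOn_univ] at hb ⊢
    rw [locallyIntegrable_iff] at hb ⊢
    intro K hK
    have hK' : IsCompact ((fun x => x - a) '' K) := hK.image (by fun_prop)
    have h := hb _ hK'
    have mp := measurePreserving_sub_right (volume : Measure (Eu N)) a
    have := (mp.integrableOn_comp_preimage (MeasurableEquiv.subRight a).measurableEmbedding
      (f := b) (s := (fun x => x - a) '' K)).2 h
    exact this.mono_set (subset_preimage_image _ _)
  refine ⟨aux hu.1, aux hu.2.1, fun φ h1 h2 h3 i => ?_⟩
  have hφ : IsTest univ φ := ⟨h1, h2, h3⟩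
  have hφ' : IsTest univ (fun x => φ (x + a)) :=
    ⟨h1.comp (by fun_prop), h2.comp_homeomorph (Homeomorph.addRight a), subset_univ _⟩
  have e := hu.integral_eq hφ' i
  simp_rw [fderiv_comp_add_right] at e
  simp only [Measure.restrict_univ] at e ⊢
  have t1 := integral_sub_right_eq_self (μ := (volume : Measure (Eu N)))
    (fun x => u x * fderiv ℝ φ (x + a) (EuclideanSpace.single i 1)) a
  have t2 := integral_sub_right_eq_self (μ := (volume : Measure (Eu N)))
    (fun x => g x i * φ (x + a)) a
  simp only [sub_add_cancel] at t1 t2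
  rw [t1, t2, e]

end HasWeakGradient

/-! ### Norms of averages -/

section averaging

variable {α β F : Type*} [MeasurableSpace α] [MeasurableSpace β] [NormedAddCommGroup F]

/-- Jensen's inequality for the power `p`, read off from the monotonicity of `eLpNorm'` in the
exponent under a probability measure. -/
lemma lintegral_rpow_le_of_isProbabilityMeasure {ν : Measure β} [IsProbabilityMeasure ν] {p : ℝ}
    (hp : 1 ≤ p) {h : β → ℝ≥0∞} (hh : AEMeasurable h ν) :
    (∫⁻ t, h t ∂ν) ^ p ≤ ∫⁻ t, h t ^ p ∂ν := by
  have h1 := eLpNorm'_le_eLpNorm'_of_exponent_le (f := h) one_pos hp ν hh.aestronglyMeasurable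
  have hp0 : 0 < p := one_pos.trans_le hp
  simp only [eLpNorm', enorm_eq_self, ENNReal.rpow_one, div_one] at h1
  have h2 := ENNReal.rpow_le_rpow h1 hp0.le
  rwa [← ENNReal.rpow_mul, one_div, inv_mul_cancel₀ hp0.ne', ENNReal.rpow_one] at h2

/-- An average of functions has an `L^p` norm that is at most the largest of their norms. -/
lemma eLpNorm_le_of_enorm_le_lintegral {μ : Measure α} [SFinite μ] {ν : Measure β}
    [IsProbabilityMeasure ν] {p : ℝ≥0∞} (hp : 1 ≤ p) (hp' : p ≠ ⊤) {k : α → F}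
    {H : α → β → ℝ≥0∞} (hH : Measurable (Function.uncurry H)) {ε : ℝ≥0∞}
    (hk : ∀ x, ‖k x‖ₑ ≤ ∫⁻ t, H x t ∂ν)
    (hε : ∀ᵐ t ∂ν, eLpNorm (fun x => H x t) p μ ≤ ε) : eLpNorm k p μ ≤ ε := by
  have hp0 : p ≠ 0 := (one_pos.trans_le hp).ne'
  have hpos : 0 < p.toReal := ENNReal.toReal_pos hp0 hp'
  have hp1 : 1 ≤ p.toReal := by
    rw [← ENNReal.toReal_one]; exact ENNReal.toReal_mono hp' hp
  rw [eLpNorm_eq_lintegral_rpow_enorm_toReal hp0 hp', one_div, ENNReal.rpow_inv_le_iff hpos]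
  -- Jensen in `t` for fixed `x`, then Tonelli, then the bound for each `t`.
  calc ∫⁻ x, ‖k x‖ₑ ^ p.toReal ∂μ ≤ ∫⁻ x, (∫⁻ t, H x t ∂ν) ^ p.toReal ∂μ := by
        gcongr with x; exact hk x
    _ ≤ ∫⁻ x, ∫⁻ t, H x t ^ p.toReal ∂ν ∂μ := by
        gcongr with x
        exact lintegral_rpow_le_of_isProbabilityMeasure hp1 hH.of_uncurry_left.aemeasurable
    _ = ∫⁻ t, ∫⁻ x, H x t ^ p.toReal ∂μ ∂ν :=
        lintegral_lintegral_swap (hH.pow_const _).aemeasurable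
    _ ≤ ∫⁻ _, ε ^ p.toReal ∂ν := by
        refine lintegral_mono_ae ?_
        filter_upwards [hε] with t ht
        rw [eLpNorm_eq_lintegral_rpow_enorm_toReal hp0 hp', one_div,
          ENNReal.rpow_inv_le_iff hpos] at ht
        simpa using ht
    _ = ε ^ p.toReal := by simp

end averaging

/-! ### Translations and mollification in `L^p` -/

section mollification

variable {N : ℕ} {F : Type*} [NormedAddCommGroup F] {p : ℝ≥0∞} {f : Eu N → F}

/-- Translations are continuous in `L^p`. -/
lemma tendsto_eLpNorm_translate_sub (hp : 1 ≤ p) (hp' : p ≠ ⊤) (hf : MemLp f p volume) :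
    Tendsto (fun a : Eu N => eLpNorm (fun x => f (x - a) - f x) p volume) (𝓝 0) (𝓝 0) := by
  have : Fact (1 ≤ p) := ⟨hp⟩
  let g : Eu N → C(Eu N, Eu N) := fun a => ⟨fun x => x - a, by fun_prop⟩
  have hg : Continuous g := by
    refine ContinuousMap.continuous_of_continuous_uncurry _ ?_
    change Continuous fun q : Eu N × Eu N => q.2 - q.1
    fun_prop
  have mp : ∀ a, MeasurePreserving (g a) (volume : Measure (Eu N)) volume := fun a =>
    measurePreserving_sub_right volume a
  have h1 : Tendsto (fun a => Lp.compMeasurePreserving (g a) (mp a) (hf.toLp f)) (𝓝 0)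
      (𝓝 (Lp.compMeasurePreserving (g 0) (mp 0) (hf.toLp f))) :=
    Filter.Tendsto.compMeasurePreservingLp tendsto_const_nhds (hg.tendsto 0) mp (mp 0) hp'
  simp_rw [Lp.toLp_compMeasurePreserving] at h1
  rw [Lp.tendsto_Lp_iff_tendsto_eLpNorm''] at h1
  refine h1.congr fun a => ?_
  congr 1
  ext x
  simp [g]

-- The mollification error is the average of `f (x - t) - f x` over `t` with the probability density
-- `ψ.normed`, so it is no larger than the worst translation error on the support of the bump.
open scoped Convolution in
open ContinuousLinearMap in
lemma eLpNorm_mollify_sub_le [NormedSpace ℝ F] [CompleteSpace F] (hp : 1 ≤ p) (hp' : p ≠ ⊤)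
    (hf : MemLp f p volume) (ψ : ContDiffBump (0 : Eu N)) {ε : ℝ≥0∞}
    (hε : ∀ a : Eu N, ‖a‖ ≤ ψ.rOut → eLpNorm (fun x => f (x - a) - f x) p volume ≤ ε) :
    eLpNorm ((ψ.normed volume ⋆[lsmul ℝ ℝ, volume] f : Eu N → F) - f) p volume ≤ ε := by
  -- Tonelli needs `f (x - t) - f x` jointly measurable in `(x, t)`; neither the convolution nor the
  -- `L^p` norms notice a change of `f` on a null set.
  wlog hm : StronglyMeasurable f generalizing f
  · have hae := hf.1.ae_eq_mk
    have h1 := this (f := hf.1.mk f) (hf.ae_eq hae) ?_ hf.1.stronglyMeasurable_mk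
    · refine le_trans (le_of_eq (eLpNorm_congr_ae ?_)) h1
      rw [convolution_congr (lsmul ℝ ℝ) (ae_eq_refl (ψ.normed volume)) hae]
      exact (ae_eq_refl _).sub hae
    · intro a ha
      refine le_trans (le_of_eq (eLpNorm_congr_ae ?_)) (hε a ha)
      have h2 := (measurePreserving_sub_right (volume : Measure (Eu N)) a).quasiMeasurePreserving.ae_eq_comp
        hae
      filter_upwards [h2, hae] with x h3 h4
      simp only [Function.comp_apply] at h3
      rw [h3, h4]
  set η : Eu N → ℝ := ψ.normed volume with hη
  have hηc : Continuous η := ψ.continuous_normed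
  set ν : Measure (Eu N) := volume.withDensity fun t => ENNReal.ofReal (η t) with hν
  have hηm : Measurable fun t => ENNReal.ofReal (η t) := hηc.measurable.ennreal_ofReal
  have hprob : IsProbabilityMeasure ν := by
    refine ⟨?_⟩
    rw [hν, withDensity_apply _ MeasurableSet.univ, Measure.restrict_univ,
      ← ofReal_integral_eq_lintegral_ofReal ψ.integrable_normed
        (Eventually.of_forall ψ.nonneg_normed), ψ.integral_normed, ENNReal.ofReal_one]
  have hloc : LocallyIntegrable f volume := hf.locallyIntegrable hp
  have hmeas : Measurable (Function.uncurry fun x t : Eu N => ‖f (x - t) - f x‖ₑ) := by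
    have h1 : StronglyMeasurable fun q : Eu N × Eu N => f (q.1 - q.2) :=
      hm.comp_measurable (measurable_fst.sub measurable_snd)
    have h2 : StronglyMeasurable fun q : Eu N × Eu N => f q.1 := hm.comp_measurable measurable_fst
    exact (h1.sub h2).enorm
  refine eLpNorm_le_of_enorm_le_lintegral (ν := ν) hp hp' hmeas (fun x => ?_) ?_
  · have i1 : Integrable (fun t => η t • f (x - t)) volume := by
      have := (ψ.hasCompactSupport_normed (μ := volume)).convolutionExists_left (lsmul ℝ ℝ)
        hηc hloc x
      exact this
    have i2 : Integrable (fun t => η t • f x) volume := ψ.integrable_normed.smul_const _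
    have e : (η ⋆[lsmul ℝ ℝ, volume] f : Eu N → F) x - f x =
        ∫ t, η t • (f (x - t) - f x) := by
      simp_rw [smul_sub]
      rw [integral_sub i1 i2, integral_smul_const, ψ.integral_normed, one_smul]
      rfl
    rw [Pi.sub_apply, e]
    refine (enorm_integral_le_lintegral_enorm _).trans (le_of_eq ?_)
    rw [hν, lintegral_withDensity_eq_lintegral_mul_non_measurable _ hηm (by simp)]
    refine lintegral_congr fun t => ?_
    rw [enorm_smul, Real.enorm_eq_ofReal (ψ.nonneg_normed t)]
    rfl
  · have : ∀ᵐ t ∂ν, ‖t‖ ≤ ψ.rOut := by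
      rw [hν, ae_withDensity_iff hηm]
      refine Eventually.of_forall fun t ht => ?_
      have h1 : t ∈ Function.support η := by
        intro h0
        simp [h0] at ht
      rw [hη, ψ.support_normed_eq] at h1
      exact (mem_ball_zero_iff.1 h1).le
    filter_upwards [this] with t ht
    have := hε t ht
    rwa [← eLpNorm_enorm] at this

end mollification

/-! ### Approximation by mollification on the whole space -/

section whole_space

variable {N : ℕ} {p : ℝ≥0∞} {f : Eu N → ℝ} {g : Eu N → Eu N}

open scoped Convolution
open ContinuousLinearMap

/-- The derivative falls on the kernel, and `y ↦ ψ (x - y)` is a test function, so the definition of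
the weak gradient moves it onto `f`. -/
lemma gradient_mollify (h : HasWeakGradient univ f g) (ψ : ContDiffBump (0 : Eu N)) :
    gradient (ψ.normed volume ⋆[lsmul ℝ ℝ, volume] f : Eu N → ℝ) =
      (ψ.normed volume ⋆[lsmul ℝ ℝ, volume] g : Eu N → Eu N) := by
  have hf : LocallyIntegrable f volume := locallyIntegrableOn_univ.1 h.1
  have hg : LocallyIntegrable g volume := locallyIntegrableOn_univ.1 h.2.1
  have hc : HasCompactSupport (ψ.normed volume) := ψ.hasCompactSupport_normed
  have hd : ContDiff ℝ 1 (ψ.normed volume) := ψ.contDiff_normed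
  ext x i
  rw [gradient_apply_eq, (hc.hasFDerivAt_convolution_left (lsmul ℝ ℝ) hd hf x).fderiv]
  have hφ : IsTest univ (fun y => ψ.normed volume (x - y)) := by
    refine ⟨(ψ.contDiff_normed (n := ⊤)).comp (by fun_prop), ?_, subset_univ _⟩
    exact hc.comp_homeomorph (Homeomorph.subLeft x)
  have e := h.integral_eq hφ i
  have d : ∀ y, fderiv ℝ (fun y => ψ.normed volume (x - y)) y (EuclideanSpace.single i 1) =
      - fderiv ℝ (ψ.normed volume) (x - y) (EuclideanSpace.single i 1) := by
    intro y
    have h1 : HasFDerivAt (ψ.normed volume) (fderiv ℝ (ψ.normed volume) (x - y)) (x - y) :=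
      (hd.differentiable (by simp) _).hasFDerivAt
    have h2 : HasFDerivAt (fun y : Eu N => x - y) (-ContinuousLinearMap.id ℝ (Eu N)) y :=
      (hasFDerivAt_id y).const_sub x
    have h3 : HasFDerivAt (fun y => ψ.normed volume (x - y)) _ y := h1.comp y h2
    rw [h3.fderiv]
    simp
  simp_rw [d, mul_neg, integral_neg, neg_inj, Measure.restrict_univ] at e
  have i1 := (hc.fderiv ℝ).convolutionExists_left ((lsmul ℝ ℝ).precompL (Eu N) :
    (Eu N →L[ℝ] ℝ) →L[ℝ] ℝ →L[ℝ] (Eu N →L[ℝ] ℝ)) (hd.continuous_fderiv (by simp)) hf x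
  have i2 := hc.convolutionExists_left (lsmul ℝ ℝ : ℝ →L[ℝ] Eu N →L[ℝ] Eu N) hd.continuous hg x
  rw [convolution_def, ContinuousLinearMap.integral_apply i1]
  have e2 : (∫ t, lsmul ℝ ℝ (ψ.normed volume t) (g (x - t))) i =
      ∫ t, (lsmul ℝ ℝ (ψ.normed volume t) (g (x - t)) : Eu N) i :=
    ((EuclideanSpace.proj i : Eu N →L[ℝ] ℝ).integral_comp_comm i2).symm
  rw [convolution_def, e2, ← integral_sub_left_eq_self _ volume x,
    ← integral_sub_left_eq_self (fun t => (lsmul ℝ ℝ (ψ.normed volume t) (g (x - t)) : Eu N) i)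
      volume x]
  simp only [sub_sub_cancel]
  convert e using 2
  · ext y
    simp [mul_comm]
  · ext y
    simp [mul_comm]

lemma contDiff_mollify (hf : LocallyIntegrable f volume) (ψ : ContDiffBump (0 : Eu N)) :
    ContDiff ℝ ∞ (ψ.normed volume ⋆[lsmul ℝ ℝ, volume] f : Eu N → ℝ) :=
  ψ.hasCompactSupport_normed.contDiff_convolution_left _ ψ.contDiff_normed hf

/-- A function in `W^{1,p}(ℝ^N)` is approximated by its mollifications. -/
lemma HasWeakGradient.eventually_mollify_le (h : HasWeakGradient univ f g) (hp : 1 ≤ p)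
    (hp' : p ≠ ⊤) (hf : MemLp f p volume) (hg : MemLp g p volume) {ε : ℝ≥0∞} (hε : ε ≠ 0) :
    ∃ δ > 0, ∀ ψ : ContDiffBump (0 : Eu N), ψ.rOut < δ →
      eLpNorm (f - (ψ.normed volume ⋆[lsmul ℝ ℝ, volume] f : Eu N → ℝ)) p volume ≤ ε ∧
      eLpNorm (g - gradient (ψ.normed volume ⋆[lsmul ℝ ℝ, volume] f : Eu N → ℝ)) p volume ≤ ε := by
  have h1 := (tendsto_eLpNorm_translate_sub hp hp' hf).eventually_le_const
    (pos_iff_ne_zero.2 hε)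
  have h2 := (tendsto_eLpNorm_translate_sub hp hp' hg).eventually_le_const
    (pos_iff_ne_zero.2 hε)
  obtain ⟨δ, hδ, H⟩ := Metric.eventually_nhds_iff.1 (h1.and h2)
  refine ⟨δ, hδ, fun ψ hψ => ⟨?_, ?_⟩⟩
  · rw [eLpNorm_sub_comm]
    refine eLpNorm_mollify_sub_le hp hp' hf ψ fun a ha => (H ?_).1
    simpa using ha.trans_lt hψ
  · rw [eLpNorm_sub_comm, gradient_mollify h]
    refine eLpNorm_mollify_sub_le hp hp' hg ψ fun a ha => (H ?_).2
    simpa using ha.trans_lt hψ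

lemma tsupport_mollify_subset {K : Set (Eu N)} (hf : ∀ x ∉ K, f x = 0)
    (ψ : ContDiffBump (0 : Eu N)) :
    tsupport (ψ.normed volume ⋆[lsmul ℝ ℝ, volume] f : Eu N → ℝ) ⊆
      Metric.cthickening ψ.rOut K := by
  refine closure_minimal ?_ Metric.isClosed_cthickening
  refine (support_convolution_subset (L := lsmul ℝ ℝ)).trans ?_
  rintro _ ⟨a, ha, b, hb, rfl⟩
  rw [ψ.support_normed_eq, mem_ball_zero_iff] at ha
  have hbK : b ∈ K := by
    by_contra h
    exact hb (hf b h)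
  refine Metric.mem_cthickening_of_dist_le _ b _ _ hbK ?_
  simpa using ha.le

/-- A pair `(f, g)` is in the closure of the pairs `(φ, ∇φ)` with `φ ∈ C_c^∞(Ω)` in `L^p`. -/
def ApproxByTest (Ω : Set (Eu N)) (p : ℝ≥0∞) (f : Eu N → ℝ) (g : Eu N → Eu N) : Prop :=
  ∀ ε : ℝ≥0∞, ε ≠ 0 → ∃ φ, IsTest Ω φ ∧ eLpNorm (f - φ) p volume ≤ ε ∧
    eLpNorm (g - gradient φ) p volume ≤ ε

/-- A function in `W^{1,p}(ℝ^N)` with compact support in `Ω` is in `W_0^{1,p}(Ω)`. -/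
lemma HasWeakGradient.approxByTest {Ω K : Set (Eu N)} (hΩ : IsOpen Ω) (hK : IsCompact K)
    (hKΩ : K ⊆ Ω) (h : HasWeakGradient univ f g) (hp : 1 ≤ p)
    (hp' : p ≠ ⊤) (hf : MemLp f p volume) (hg : MemLp g p volume) (hfK : ∀ x ∉ K, f x = 0) :
    ApproxByTest Ω p f g := by
  intro ε hε
  obtain ⟨δ, hδ, H⟩ := h.eventually_mollify_le hp hp' hf hg hε
  obtain ⟨r, hr, hrΩ⟩ := hK.exists_cthickening_subset_open hΩ hKΩ
  set s := min δ r with hs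
  have hs0 : 0 < s := lt_min hδ hr
  -- The outer radius is below `δ`, for the error estimate, and below `r`, to keep the support in
  -- `Ω`.
  let ψ : ContDiffBump (0 : Eu N) := ⟨s / 4, s / 2, by positivity, by linarith⟩
  have hψ : ψ.rOut = s / 2 := rfl
  have hsub : tsupport (ψ.normed volume ⋆[lsmul ℝ ℝ, volume] f : Eu N → ℝ) ⊆
      Metric.cthickening r K := by
    refine (tsupport_mollify_subset hfK ψ).trans (Metric.cthickening_mono ?_ K)
    rw [hψ]
    linarith [min_le_right δ r]
  refine ⟨_, ⟨contDiff_mollify (hf.locallyIntegrable hp) ψ, ?_, hsub.trans hrΩ⟩, H ψ ?_⟩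
  · exact hK.cthickening.of_isClosed_subset (isClosed_tsupport _) hsub
  · rw [hψ]
    linarith [min_le_left δ r]

end whole_space

/-! ### Limits of test functions -/

namespace ApproxByTest

variable {N : ℕ} {Ω : Set (Eu N)} {p q : ℝ≥0∞} {f f' : Eu N → ℝ} {g g' : Eu N → Eu N}

lemma congr_ae (h : ApproxByTest Ω p f g) (hf : f =ᵐ[volume] f') (hg : g =ᵐ[volume] g') :
    ApproxByTest Ω p f' g' := by
  intro ε hε
  obtain ⟨φ, hφ, h1, h2⟩ := h ε hε
  refine ⟨φ, hφ, (eLpNorm_congr_ae ?_).trans_le h1, (eLpNorm_congr_ae ?_).trans_le h2⟩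
  · exact hf.symm.sub (ae_eq_refl _)
  · exact hg.symm.sub (ae_eq_refl _)

lemma zero : ApproxByTest Ω p (0 : Eu N → ℝ) 0 := by
  intro ε _
  refine ⟨0, IsTest.zero, ?_, ?_⟩ <;> simp [gradient_zero]

lemma add (hp : 1 ≤ p) (mf : AEStronglyMeasurable f volume) (mg : AEStronglyMeasurable g volume)
    (mf' : AEStronglyMeasurable f' volume) (mg' : AEStronglyMeasurable g' volume)
    (h : ApproxByTest Ω p f g) (h' : ApproxByTest Ω p f' g') :
    ApproxByTest Ω p (f + f') (g + g') := by
  intro ε hε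
  have hε2 : ε / 2 ≠ 0 := (ENNReal.half_pos hε).ne'
  obtain ⟨φ, hφ, h1, h2⟩ := h _ hε2
  obtain ⟨φ', hφ', h1', h2'⟩ := h' _ hε2
  refine ⟨φ + φ', hφ.add hφ', ?_, ?_⟩
  · rw [add_sub_add_comm, ← ENNReal.add_halves ε]
    exact (eLpNorm_add_le (mf.sub hφ.continuous.aestronglyMeasurable)
      (mf'.sub hφ'.continuous.aestronglyMeasurable) hp).trans (add_le_add h1 h1')
  · rw [gradient_add hφ.differentiable hφ'.differentiable, add_sub_add_comm,
      ← ENNReal.add_halves ε]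
    exact (eLpNorm_add_le (mg.sub (hφ.memLp_gradient p _).1)
      (mg'.sub (hφ'.memLp_gradient p _).1) hp).trans (add_le_add h2 h2')

lemma sum (hp : 1 ≤ p) {ι : Type*} (s : Finset ι) {f : ι → Eu N → ℝ} {g : ι → Eu N → Eu N}
    (mf : ∀ i ∈ s, AEStronglyMeasurable (f i) volume)
    (mg : ∀ i ∈ s, AEStronglyMeasurable (g i) volume)
    (h : ∀ i ∈ s, ApproxByTest Ω p (f i) (g i)) :
    ApproxByTest Ω p (∑ i ∈ s, f i) (∑ i ∈ s, g i) := by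
  classical
  induction s using Finset.induction_on with
  | empty => simpa using zero
  | insert a s ha ih =>
    rw [Finset.sum_insert ha, Finset.sum_insert ha]
    have mf' := fun i hi => mf i (Finset.mem_insert_of_mem hi)
    have mg' := fun i hi => mg i (Finset.mem_insert_of_mem hi)
    exact add hp (mf a (Finset.mem_insert_self _ _)) (mg a (Finset.mem_insert_self _ _))
      (Finset.aestronglyMeasurable_sum _ mf') (Finset.aestronglyMeasurable_sum _ mg')
      (h a (Finset.mem_insert_self _ _)) (ih mf' mg' fun i hi => h i (Finset.mem_insert_of_mem hi))

lemma const_smul (c : ℝ) (h : ApproxByTest Ω p f g) : ApproxByTest Ω p (c • f) (c • g) := by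
  intro ε hε
  rcases eq_or_ne c 0 with rfl | hc
  · simpa using zero (Ω := Ω) (p := p) ε hε
  have hc0 : ‖c‖ₑ ≠ 0 := by simpa using hc
  obtain ⟨φ, hφ, h1, h2⟩ := h (ε / ‖c‖ₑ) (ENNReal.div_ne_zero.2 ⟨hε, by simp⟩)
  refine ⟨c • φ, hφ.const_smul c, ?_, ?_⟩
  · rw [← smul_sub, eLpNorm_const_smul]
    calc ‖c‖ₑ * eLpNorm (f - φ) p volume ≤ ‖c‖ₑ * (ε / ‖c‖ₑ) := by gcongr
      _ ≤ ε := ENNReal.mul_div_le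
  · rw [gradient_const_smul _ hφ.differentiable, ← smul_sub, eLpNorm_const_smul]
    calc ‖c‖ₑ * eLpNorm (g - gradient φ) p volume ≤ ‖c‖ₑ * (ε / ‖c‖ₑ) := by gcongr
      _ ≤ ε := ENNReal.mul_div_le

lemma of_approx (hp : 1 ≤ p) (mf : AEStronglyMeasurable f volume)
    (mg : AEStronglyMeasurable g volume)
    (h : ∀ ε : ℝ≥0∞, ε ≠ 0 → ∃ f' g', AEStronglyMeasurable f' volume ∧
      AEStronglyMeasurable g' volume ∧ ApproxByTest Ω p f' g' ∧
      eLpNorm (f - f') p volume ≤ ε ∧ eLpNorm (g - g') p volume ≤ ε) :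
    ApproxByTest Ω p f g := by
  intro ε hε
  have hε2 : ε / 2 ≠ 0 := (ENNReal.half_pos hε).ne'
  obtain ⟨f', g', mf', mg', h', h1, h2⟩ := h _ hε2
  obtain ⟨φ, hφ, h1', h2'⟩ := h' _ hε2
  refine ⟨φ, hφ, ?_, ?_⟩
  · rw [← sub_add_sub_cancel f f' φ, ← ENNReal.add_halves ε]
    exact (eLpNorm_add_le (mf.sub mf') (mf'.sub hφ.continuous.aestronglyMeasurable) hp).trans
      (add_le_add h1 h1')
  · rw [← sub_add_sub_cancel g g' _, ← ENNReal.add_halves ε]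
    exact (eLpNorm_add_le (mg.sub mg') (mg'.sub (hφ.memLp_gradient p _).1) hp).trans
      (add_le_add h2 h2')

/-- Here the zero boundary values enter: the approximants are smooth on all of `ℝ^N`, so the limit
has a weak gradient across `∂Ω` and not merely inside `Ω`. -/
lemma hasWeakGradient (hp : 1 ≤ p) (hf : MemLp f p volume) (hg : MemLp g p volume)
    (h : ApproxByTest Ω p f g) : HasWeakGradient univ f g := by
  refine HasWeakGradient.of_approx hp (hf.restrict _) (hg.restrict _) fun ε hε => ?_
  obtain ⟨φ, hφ, h1, h2⟩ := h ε hε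
  refine ⟨φ, gradient φ, .of_contDiff hφ.contDiff_one, hφ.continuous.aestronglyMeasurable,
    (hφ.memLp_gradient p _).1, ?_, ?_⟩ <;> rwa [Measure.restrict_univ]

lemma exists_seq (h : ApproxByTest Ω p f g) :
    ∃ φ : ℕ → Eu N → ℝ, (∀ n, IsTest Ω (φ n)) ∧
      Tendsto (fun n => eLpNorm (φ n - f) p volume) atTop (𝓝 0) ∧
      Tendsto (fun n => eLpNorm (gradient (φ n) - g) p volume) atTop (𝓝 0) := by
  -- At `n = 0` the tolerance is `∞`, which does no harm.
  have h0 : ∀ n : ℕ, ((n : ℝ≥0∞))⁻¹ ≠ 0 := fun n => by simp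
  choose φ hφ h1 h2 using fun n : ℕ => h _ (h0 n)
  refine ⟨φ, hφ, ?_, ?_⟩
  · refine tendsto_of_tendsto_of_tendsto_of_le_of_le tendsto_const_nhds
      ENNReal.tendsto_inv_nat_nhds_zero (fun _ => zero_le) fun n => ?_
    rw [eLpNorm_sub_comm]
    exact h1 n
  · refine tendsto_of_tendsto_of_tendsto_of_le_of_le tendsto_const_nhds
      ENNReal.tendsto_inv_nat_nhds_zero (fun _ => zero_le) fun n => ?_
    rw [eLpNorm_sub_comm]
    exact h2 n

/-- A Sobolev type inequality for test functions extends to limits of test functions. -/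
lemma eLpNorm_le {C : ℝ≥0∞} (hC : C ≠ ⊤) (hp : 1 ≤ p) (hf : MemLp f p volume)
    (hg : MemLp g p volume) (h : ApproxByTest Ω p f g)
    (H : ∀ φ, IsTest Ω φ → eLpNorm φ q volume ≤ C * eLpNorm (gradient φ) p volume) :
    eLpNorm f q volume ≤ C * eLpNorm g p volume := by
  obtain ⟨φ, hφ, h1, h2⟩ := h.exists_seq
  -- An almost everywhere convergent subsequence lets Fatou bound the `L^q` norm of `f`, without
  -- knowing beforehand that it is finite.
  have hm := tendstoInMeasure_of_tendsto_eLpNorm (one_pos.trans_le hp).ne'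
    (fun n => (hφ n).continuous.aestronglyMeasurable) hf.1 h1
  obtain ⟨ns, hns, hae⟩ := hm.exists_seq_tendsto_ae
  refine (Lp.eLpNorm_lim_le_liminf_eLpNorm
    (fun n => (hφ (ns n)).continuous.aestronglyMeasurable) f hae).trans ?_
  have hlim : Tendsto (fun n => C * (eLpNorm (gradient (φ (ns n)) - g) p volume +
      eLpNorm g p volume)) atTop (𝓝 (C * (0 + eLpNorm g p volume))) :=
    ENNReal.Tendsto.const_mul ((h2.comp hns.tendsto_atTop).add tendsto_const_nhds) (Or.inr hC)
  rw [zero_add] at hlim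
  rw [← hlim.liminf_eq]
  refine liminf_le_liminf (Eventually.of_forall fun n => (H _ (hφ (ns n))).trans ?_)
  gcongr
  conv_lhs => rw [← sub_add_cancel (gradient (φ (ns n))) g]
  exact eLpNorm_add_le (((hφ (ns n)).memLp_gradient p _).1.sub hg.1) hg.1 hp

end ApproxByTest

/-! ### Poincaré, Sobolev and Morrey inequalities for test functions -/

section inequalities

variable {N : ℕ}

lemma exists_norm_eq_of_pos (hN : 1 ≤ N) {r : ℝ} (hr : 0 ≤ r) : ∃ v : Eu N, ‖v‖ = r :=
  ⟨EuclideanSpace.single ⟨0, hN⟩ r, by simp [abs_of_nonneg hr]⟩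

/-- The fundamental theorem of calculus on the segment from `x` to `x + v`, as a lower integral so
that Tonelli applies without integrability conditions. -/
lemma enorm_sub_le_lintegral_gradient {φ : Eu N → ℝ} (hφ : ContDiff ℝ 1 φ) (x v : Eu N) :
    ‖φ (x + v) - φ x‖ₑ ≤ ∫⁻ t in Ioc (0 : ℝ) 1, ‖v‖ₑ * ‖gradient φ (x + t • v)‖ₑ := by
  have hd : ∀ t ∈ uIcc (0 : ℝ) 1, HasDerivAt (fun t : ℝ => φ (x + t • v))
      (fderiv ℝ φ (x + t • v) v) t := by
    intro t _
    have h1 : HasDerivAt (fun t : ℝ => x + t • v) v t := by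
      simpa using ((hasDerivAt_id t).smul_const v).const_add x
    exact (hφ.differentiable (by simp) _).hasFDerivAt.comp_hasDerivAt t h1
  have hc : Continuous fun t : ℝ => fderiv ℝ φ (x + t • v) v :=
    ((hφ.continuous_fderiv (by simp)).comp (by fun_prop)).clm_apply continuous_const
  have e := intervalIntegral.integral_eq_sub_of_hasDerivAt hd (hc.intervalIntegrable 0 1)
  simp only [one_smul, zero_smul, add_zero] at e
  rw [← e, intervalIntegral.integral_of_le zero_le_one]
  refine (enorm_integral_le_lintegral_enorm _).trans (lintegral_mono fun t => ?_)
  rw [mul_comm]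
  have := (fderiv ℝ φ (x + t • v)).le_opNorm v
  rw [← norm_gradient] at this
  rw [← ofReal_norm, ← ofReal_norm, ← ofReal_norm,
    ← ENNReal.ofReal_mul (norm_nonneg _)]
  exact ENNReal.ofReal_le_ofReal this

lemma measurable_enorm_gradient_segment {φ : Eu N → ℝ} (hφ : ContDiff ℝ 1 φ) (v : Eu N) :
    Measurable (Function.uncurry fun (x : Eu N) (t : ℝ) =>
      ‖v‖ₑ * ‖gradient φ (x + t • v)‖ₑ) := by
  have : Continuous (Function.uncurry fun (x : Eu N) (t : ℝ) => gradient φ (x + t • v)) :=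
    (continuous_gradient hφ).comp (by fun_prop)
  exact this.measurable.enorm.const_mul _

/-- The Poincaré inequality for test functions. -/
lemma poincare_isTest (hN : 1 ≤ N) {p : ℝ≥0∞} (hp : 1 ≤ p) (hp' : p ≠ ⊤) {R : ℝ} (hR : 0 ≤ R)
    {φ : Eu N → ℝ} (hφ : IsTest (Metric.closedBall 0 R) φ) :
    eLpNorm φ p volume ≤ ENNReal.ofReal (2 * R + 1) * eLpNorm (gradient φ) p volume := by
  -- A step longer than the diameter `2 R` leaves the ball from any of its points, so `φ (x + v) =
  -- 0` there.
  obtain ⟨v, hv⟩ := exists_norm_eq_of_pos hN (r := 2 * R + 1) (by positivity)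
  have : IsProbabilityMeasure (volume.restrict (Ioc (0 : ℝ) 1)) := ⟨by simp⟩
  have hv' : ‖v‖ₑ = ENNReal.ofReal (2 * R + 1) := by rw [← ofReal_norm, hv]
  refine eLpNorm_le_of_enorm_le_lintegral hp hp'
    (measurable_enorm_gradient_segment hφ.contDiff_one v) (ν := volume.restrict (Ioc (0 : ℝ) 1))
    (fun x => ?_) (Eventually.of_forall fun t => ?_)
  · by_cases hx : x ∈ Metric.closedBall (0 : Eu N) R
    · have hxv : x + v ∉ Metric.closedBall (0 : Eu N) R := by
        rw [mem_closedBall_zero_iff] at hx ⊢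
        have := norm_sub_le (x + v) x
        rw [add_sub_cancel_left] at this
        intro h
        linarith
      have := enorm_sub_le_lintegral_gradient hφ.contDiff_one x v
      rwa [hφ.eq_zero hxv, zero_sub, enorm_neg] at this
    · rw [hφ.eq_zero hx]
      simp
  · have h1 : eLpNorm (fun x => ‖v‖ₑ * ‖gradient φ (x + t • v)‖ₑ) p volume =
        eLpNorm (fun x => ‖v‖ • gradient φ (x + t • v)) p volume := by
      rw [← eLpNorm_enorm (fun x => ‖v‖ • gradient φ (x + t • v))]
      simp_rw [enorm_smul, enorm_norm]
    have h2 := eLpNorm_comp_measurePreserving (p := p)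
      (hφ.memLp_gradient p volume).1 (measurePreserving_add_right volume (t • v))
    rw [h1, ← hv', ← h2]
    refine (eLpNorm_const_smul_le (c := ‖v‖)
      (f := fun x => gradient φ (x + t • v))).trans (le_of_eq ?_)
    rw [enorm_norm]
    rfl

/-- The Sobolev inequality for test functions. -/
lemma exists_sobolev_isTest (hN : 1 ≤ N) {p q : ℝ} (hp : 1 ≤ p) (hq : q⁻¹ = p⁻¹ - (N : ℝ)⁻¹)
    (hq0 : 0 ≤ q) :
    ∃ C : ℝ≥0∞, C ≠ ⊤ ∧ ∀ φ : Eu N → ℝ, IsTest univ φ →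
      eLpNorm φ (ENNReal.ofReal q) volume ≤
        C * eLpNorm (gradient φ) (ENNReal.ofReal p) volume := by
  refine ⟨SNormLESNormFDerivOfEqConst ℝ (volume : Measure (Eu N)) p.toNNReal,
    ENNReal.coe_ne_top, fun φ hφ => ?_⟩
  have h1 : eLpNorm (gradient φ) (ENNReal.ofReal p) volume =
      eLpNorm (fderiv ℝ φ) (ENNReal.ofReal p) volume :=
    eLpNorm_congr_norm_ae (Eventually.of_forall fun x => norm_gradient φ x)
  rw [h1]
  have := eLpNorm_le_eLpNorm_fderiv_of_eq (volume : Measure (Eu N)) hφ.contDiff_one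
    hφ.hasCompactSupport (p := p.toNNReal) (p' := q.toNNReal) ?_ ?_ ?_
  · simpa [ENNReal.ofReal] using this
  · simpa using hp
  · simpa using (by omega : 0 < N)
  · rw [NNReal.coe_inv, Real.coe_toNNReal _ hq0, Real.coe_toNNReal _ (zero_le_one.trans hp), hq]
    simp

/-- The dilation `y ↦ t y` scales Lebesgue measure by `t ^ (-N)`; the `p`-th root gives the exponent
`-N / p`. -/
lemma eLpNorm_comp_smul {F : Type*} [NormedAddCommGroup F] {p : ℝ≥0∞} (hp : p ≠ ⊤)
    {G : Eu N → F} (hG : Continuous G) {t : ℝ} (ht : 0 < t) :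
    eLpNorm (fun y => G (t • y)) p volume =
      ENNReal.ofReal (t ^ (-(N : ℝ) * (p.toReal)⁻¹)) * eLpNorm G p volume := by
  have h1 := eLpNorm_map_measure (μ := volume) (p := p) (f := fun y : Eu N => t • y) (g := G)
    hG.aestronglyMeasurable (by fun_prop)
  rw [Measure.map_addHaar_smul _ ht.ne', eLpNorm_smul_measure_of_ne_top hp] at h1
  change _ = eLpNorm (G ∘ fun y => t • y) p volume at h1
  rw [show (fun y => G (t • y)) = G ∘ fun y => t • y from rfl, ← h1, smul_eq_mul]
  congr 1
  rw [ENNReal.ofReal_rpow_of_nonneg (abs_nonneg _) ENNReal.toReal_nonneg]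
  congr 1
  rw [finrank_euclideanSpace_fin, abs_of_pos (by positivity), one_div, ENNReal.toReal_inv,
    ← Real.rpow_natCast, ← Real.rpow_neg ht.le, ← Real.rpow_mul ht.le]

/-- Morrey's bound for test functions. -/
lemma exists_sup_bound_isTest (hN : 1 ≤ N) {p : ℝ≥0∞} (hp' : p ≠ ⊤)
    (hpN : (N : ℝ) < p.toReal) {R : ℝ} (hR : 0 ≤ R) :
    ∃ C : ℝ≥0∞, C ≠ ⊤ ∧ ∀ φ : Eu N → ℝ, IsTest (Metric.closedBall 0 R) φ →
      ∀ x, ‖φ x‖ₑ ≤ C * eLpNorm (gradient φ) p volume := by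
  -- For `‖x‖ ≤ R` and `y` within `1` of `c`, the norm of `y` is between `2 R + 1` and `2 R + 3`:
  -- the point `x + y` is outside the ball, and the segments have bounded length.
  obtain ⟨c, hc⟩ := exists_norm_eq_of_pos hN (r := 2 * R + 2) (by positivity)
  have hN' : (1 : ℝ) ≤ N := by exact_mod_cast hN
  have hp1 : 1 ≤ p := by
    rw [← ENNReal.toReal_le_toReal (by simp) hp', ENNReal.toReal_one]
    linarith
  have hp0 : 0 < p.toReal := by linarith
  set A : Set (Eu N) := Metric.ball c 1
  have hA0 : volume A ≠ 0 := (Metric.measure_ball_pos volume c one_pos).ne'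
  have hAt : volume A ≠ ⊤ := Metric.isBounded_ball.measure_lt_top.ne
  set M : ℝ≥0∞ := ENNReal.ofReal (2 * R + 3)
  set D : ℝ≥0∞ := volume A ^ (1 / (1 : ℝ≥0∞).toReal - 1 / p.toReal)
  have hD : D ≠ ⊤ := by
    refine ENNReal.rpow_ne_top_of_nonneg ?_ hAt
    have : 1 / p.toReal ≤ 1 := by
      rw [div_le_one hp0]
      linarith
    simpa using this
  -- The singularity at `t = 0` comes from shrinking `A` by the factor `t`; it is integrable because
  -- `N / p < 1`.
  set I : ℝ≥0∞ := ∫⁻ t in Ioc (0 : ℝ) 1, ENNReal.ofReal (t ^ (-(N : ℝ) * (p.toReal)⁻¹))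
  have hI : I ≠ ⊤ := by
    have h1 : -1 < -(N : ℝ) * (p.toReal)⁻¹ := by
      rw [neg_mul, neg_lt_neg_iff, ← div_eq_mul_inv, div_lt_one hp0]
      exact hpN
    have h2 := (intervalIntegrable_iff_integrableOn_Ioc_of_le zero_le_one).1
      (intervalIntegral.intervalIntegrable_rpow' (a := 0) (b := 1) h1)
    exact h2.lintegral_lt_top.ne
  refine ⟨(volume A)⁻¹ * (M * D * I), ENNReal.mul_ne_top (ENNReal.inv_ne_top.2 hA0)
    (ENNReal.mul_ne_top (ENNReal.mul_ne_top ENNReal.ofReal_ne_top hD) hI), fun φ hφ x => ?_⟩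
  by_cases hx : x ∈ Metric.closedBall (0 : Eu N) R
  swap
  · rw [hφ.eq_zero hx]
    simp
  rw [mem_closedBall_zero_iff] at hx
  have hG := continuous_gradient hφ.contDiff_one
  have key : ∀ y ∈ A, ‖φ x‖ₑ ≤ ∫⁻ t in Ioc (0 : ℝ) 1, M * ‖gradient φ (x + t • y)‖ₑ := by
    intro y hy
    have hy1 : ‖y - c‖ < 1 := by simpa [A, dist_eq_norm] using hy
    have hy2 : ‖y‖ ≤ 2 * R + 3 := by
      have := norm_add_le (y - c) c
      rw [sub_add_cancel] at this
      linarith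
    have hy3 : x + y ∉ Metric.closedBall (0 : Eu N) R := by
      rw [mem_closedBall_zero_iff, not_le]
      have h1 := norm_sub_le (x + y) x
      rw [add_sub_cancel_left] at h1
      have h2 := norm_sub_le y (y - c)
      rw [sub_sub_cancel] at h2
      linarith
    have h1 := enorm_sub_le_lintegral_gradient hφ.contDiff_one x y
    rw [hφ.eq_zero hy3, zero_sub, enorm_neg] at h1
    refine h1.trans (lintegral_mono fun t => ?_)
    gcongr
    rw [← ofReal_norm]
    exact ENNReal.ofReal_le_ofReal hy2
  have hmeas : Measurable (Function.uncurry fun (y : Eu N) (t : ℝ) =>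
      M * ‖gradient φ (x + t • y)‖ₑ) := by
    have : Continuous (Function.uncurry fun (y : Eu N) (t : ℝ) => gradient φ (x + t • y)) :=
      hG.comp (by fun_prop)
    exact this.measurable.enorm.const_mul _
  -- Averaging over `y ∈ A`: Tonelli, Hölder on `A` for fixed `t`, then the dilation rule.
  have step : volume A * ‖φ x‖ₑ ≤ M * D * I * eLpNorm (gradient φ) p volume := by
    calc volume A * ‖φ x‖ₑ = ∫⁻ _ in A, ‖φ x‖ₑ := by rw [setLIntegral_const, mul_comm]
      _ ≤ ∫⁻ y in A, ∫⁻ t in Ioc (0 : ℝ) 1, M * ‖gradient φ (x + t • y)‖ₑ :=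
        setLIntegral_mono' measurableSet_ball key
      _ = ∫⁻ t in Ioc (0 : ℝ) 1, ∫⁻ y in A, M * ‖gradient φ (x + t • y)‖ₑ :=
        lintegral_lintegral_swap hmeas.aemeasurable
      _ ≤ ∫⁻ t in Ioc (0 : ℝ) 1, M * D * eLpNorm (gradient φ) p volume *
            ENNReal.ofReal (t ^ (-(N : ℝ) * (p.toReal)⁻¹)) := by
        refine setLIntegral_mono' measurableSet_Ioc fun t ht => ?_
        have hc1 : Continuous fun y : Eu N => gradient φ (x + t • y) := hG.comp (by fun_prop)
        rw [lintegral_const_mul _ hc1.measurable.enorm, ← eLpNorm_one_eq_lintegral_enorm]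
        have h1 := eLpNorm_le_eLpNorm_mul_rpow_measure_univ hp1
          (hc1.aestronglyMeasurable (μ := volume.restrict A))
        rw [Measure.restrict_apply_univ] at h1
        have h2 : eLpNorm (fun y : Eu N => gradient φ (x + t • y)) p (volume.restrict A) ≤
            ENNReal.ofReal (t ^ (-(N : ℝ) * (p.toReal)⁻¹)) * eLpNorm (gradient φ) p volume := by
          refine (eLpNorm_mono_measure _ Measure.restrict_le_self).trans ?_
          have h3 := eLpNorm_comp_smul hp' (G := fun z => gradient φ (x + z))
            (hG.comp (by fun_prop)) ht.1
          rw [h3]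
          have h4 := eLpNorm_comp_measurePreserving (p := p)
            (hφ.memLp_gradient p volume).1 (measurePreserving_add_left volume x)
          exact le_of_eq (by rw [← h4]; rfl)
        calc M * eLpNorm (fun y : Eu N => gradient φ (x + t • y)) 1 (volume.restrict A)
            ≤ M * (ENNReal.ofReal (t ^ (-(N : ℝ) * (p.toReal)⁻¹)) *
              eLpNorm (gradient φ) p volume * D) := by
              gcongr
              exact h1.trans (by gcongr)
          _ = _ := by ring
      _ = M * D * I * eLpNorm (gradient φ) p volume := by
        rw [lintegral_const_mul' _ _ (ENNReal.mul_ne_top (ENNReal.mul_ne_top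
          ENNReal.ofReal_ne_top hD) (hφ.memLp_gradient p volume).2.ne)]
        ring
  calc ‖φ x‖ₑ = (volume A)⁻¹ * (volume A * ‖φ x‖ₑ) := by
        rw [← mul_assoc, ENNReal.inv_mul_cancel hA0 hAt, one_mul]
    _ ≤ (volume A)⁻¹ * (M * D * I * eLpNorm (gradient φ) p volume) := by gcongr
    _ = _ := by ring

end inequalities

/-! ### Sobolev functions paired with an explicit gradient -/

/-- `u` is in `W^{1,p}(Ω)` and its weak gradient is `g`. -/
structure IsSobolevPair {N : ℕ} (Ω : Set (Eu N)) (p : ℝ≥0∞) (u : Eu N → ℝ) (g : Eu N → Eu N) :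
    Prop where
  memLp : MemLp u p (volume.restrict Ω)
  hasWeakGradient : HasWeakGradient Ω u g
  memLp_grad : MemLp g p (volume.restrict Ω)

namespace IsSobolevPair

variable {N : ℕ} {Ω : Set (Eu N)} {p q : ℝ≥0∞} {u v : Eu N → ℝ} {g h : Eu N → Eu N}

lemma congr_ae (H : IsSobolevPair Ω p u g) (huv : u =ᵐ[volume.restrict Ω] v)
    (hgh : g =ᵐ[volume.restrict Ω] h) : IsSobolevPair Ω p v h :=
  ⟨H.memLp.ae_eq huv, H.hasWeakGradient.congr_ae huv hgh, H.memLp_grad.ae_eq hgh⟩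

lemma add (H : IsSobolevPair Ω p u g) (H' : IsSobolevPair Ω p v h) :
    IsSobolevPair Ω p (u + v) (g + h) :=
  ⟨H.memLp.add H'.memLp, H.hasWeakGradient.add H'.hasWeakGradient,
    H.memLp_grad.add H'.memLp_grad⟩

lemma sub (H : IsSobolevPair Ω p u g) (H' : IsSobolevPair Ω p v h) :
    IsSobolevPair Ω p (u - v) (g - h) :=
  ⟨H.memLp.sub H'.memLp, H.hasWeakGradient.sub H'.hasWeakGradient,
    H.memLp_grad.sub H'.memLp_grad⟩

lemma const_smul (c : ℝ) (H : IsSobolevPair Ω p u g) : IsSobolevPair Ω p (c • u) (c • g) :=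
  ⟨H.memLp.const_smul c, H.hasWeakGradient.const_smul c, H.memLp_grad.const_smul c⟩

lemma of_isTest {Ω' : Set (Eu N)} (hu : IsTest Ω' u) : IsSobolevPair Ω p u (gradient u) :=
  ⟨hu.memLp _ _, .of_contDiff hu.contDiff_one, hu.memLp_gradient _ _⟩

lemma mono_exponent (hΩb : Bornology.IsBounded Ω) (H : IsSobolevPair Ω q u g) (hpq : p ≤ q) :
    IsSobolevPair Ω p u g := by
  have : IsFiniteMeasure (volume.restrict Ω) :=
    ⟨by rw [Measure.restrict_apply_univ]; exact hΩb.measure_lt_top⟩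
  exact ⟨H.memLp.mono_exponent hpq, H.hasWeakGradient, H.memLp_grad.mono_exponent hpq⟩

end IsSobolevPair

/-! ### From classes and Sobolev norms to functions and `eLpNorm` -/

section transfer

variable {N : ℕ} {Ω : Set (Eu N)} {p : ℝ} {u v : MeasFun Ω} {g h : Eu N → Eu N}

lemma one_le_ofReal_of_lt (hp : 1 < p) : 1 ≤ ENNReal.ofReal p := by
  rw [← ENNReal.ofReal_one]; exact ENNReal.ofReal_le_ofReal hp.le

lemma toReal_ofReal_of_lt (hp : 1 < p) : (ENNReal.ofReal p).toReal = p :=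
  ENNReal.toReal_ofReal (zero_le_one.trans hp.le)

lemma mem_sobolevW_iff : u ∈ SobolevW Ω p ↔ ∃ g, IsSobolevPair Ω (ENNReal.ofReal p) u g :=
  ⟨fun ⟨h1, g, h2, h3⟩ => ⟨g, h1, h2, h3⟩, fun ⟨g, H⟩ => ⟨H.1, g, H.2, H.3⟩⟩

lemma IsSobolevPair.coe_add (H : IsSobolevPair Ω (ENNReal.ofReal p) u g)
    (H' : IsSobolevPair Ω (ENNReal.ofReal p) v h) :
    IsSobolevPair Ω (ENNReal.ofReal p) (u + v : MeasFun Ω) (g + h) :=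
  (H.add H').congr_ae (AEEqFun.coeFn_add u v).symm (ae_eq_refl _)

lemma IsSobolevPair.coe_sub (H : IsSobolevPair Ω (ENNReal.ofReal p) u g)
    (H' : IsSobolevPair Ω (ENNReal.ofReal p) v h) :
    IsSobolevPair Ω (ENNReal.ofReal p) (u - v : MeasFun Ω) (g - h) :=
  (H.sub H').congr_ae (AEEqFun.coeFn_sub u v).symm (ae_eq_refl _)

lemma IsSobolevPair.coe_smul (c : ℝ) (H : IsSobolevPair Ω (ENNReal.ofReal p) u g) :
    IsSobolevPair Ω (ENNReal.ofReal p) (c • u : MeasFun Ω) (c • g) :=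
  (H.const_smul c).congr_ae (AEEqFun.coeFn_smul c u).symm (ae_eq_refl _)

lemma integral_norm_rpow_eq {F : Type*} [NormedAddCommGroup F] {α : Type*} [MeasurableSpace α]
    {μ : Measure α} {f : α → F} (hp : 1 < p) (hf : MemLp f (ENNReal.ofReal p) μ) :
    ∫ x, ‖f x‖ ^ p ∂μ = (eLpNorm f (ENNReal.ofReal p) μ).toReal ^ p := by
  have hp0 : 0 < p := one_pos.trans hp
  rw [hf.eLpNorm_eq_integral_rpow_norm (one_pos.trans_le (one_le_ofReal_of_lt hp)).ne' (by simp),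
    toReal_ofReal_of_lt hp, ENNReal.toReal_ofReal (by positivity), ← Real.rpow_mul (by positivity),
    inv_mul_cancel₀ hp0.ne', Real.rpow_one]

lemma IsSobolevPair.integral_weakGradient (hΩ : IsOpen Ω) (hp : 1 < p)
    (H : IsSobolevPair Ω (ENNReal.ofReal p) u g) :
    ∫ x in Ω, ‖weakGradient Ω u x‖ ^ p =
      (eLpNorm g (ENNReal.ofReal p) (volume.restrict Ω)).toReal ^ p := by
  rw [← integral_norm_rpow_eq hp H.memLp_grad]
  refine integral_congr_ae ?_
  filter_upwards [H.hasWeakGradient.weakGradient_ae_eq hΩ] with x hx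
  rw [hx]

lemma IsSobolevPair.gradNorm_eq (hΩ : IsOpen Ω) (hp : 1 < p)
    (H : IsSobolevPair Ω (ENNReal.ofReal p) u g) :
    gradNorm Ω p u = (eLpNorm g (ENNReal.ofReal p) (volume.restrict Ω)).toReal := by
  rw [gradNorm, H.integral_weakGradient hΩ hp, ← Real.rpow_mul ENNReal.toReal_nonneg,
    mul_one_div_cancel (one_pos.trans hp).ne', Real.rpow_one]

lemma IsSobolevPair.sobolevNorm_eq (hΩ : IsOpen Ω) (hp : 1 < p)
    (H : IsSobolevPair Ω (ENNReal.ofReal p) u g) :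
    sobolevNorm Ω p u = ((eLpNorm u (ENNReal.ofReal p) (volume.restrict Ω)).toReal ^ p +
      (eLpNorm g (ENNReal.ofReal p) (volume.restrict Ω)).toReal ^ p) ^ (1 / p) := by
  rw [sobolevNorm, H.integral_weakGradient hΩ hp, ← integral_norm_rpow_eq hp H.memLp]
  rfl

lemma IsSobolevPair.sobolevNorm_le (hΩ : IsOpen Ω) (hp : 1 < p)
    (H : IsSobolevPair Ω (ENNReal.ofReal p) u g) :
    sobolevNorm Ω p u ≤ (eLpNorm u (ENNReal.ofReal p) (volume.restrict Ω)).toReal +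
      (eLpNorm g (ENNReal.ofReal p) (volume.restrict Ω)).toReal := by
  rw [H.sobolevNorm_eq hΩ hp]
  exact Real.rpow_add_rpow_le_add ENNReal.toReal_nonneg ENNReal.toReal_nonneg hp.le

lemma le_rpow_add_rpow (hp : 1 < p) {a b : ℝ} (ha : 0 ≤ a) (hb : 0 ≤ b) :
    a ≤ (a ^ p + b ^ p) ^ (1 / p) := by
  have hp0 : 0 < p := one_pos.trans hp
  calc a = (a ^ p) ^ (1 / p) := by
        rw [← Real.rpow_mul ha, mul_one_div_cancel hp0.ne', Real.rpow_one]
    _ ≤ _ := by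
        refine Real.rpow_le_rpow (by positivity) ?_ (by positivity)
        linarith [Real.rpow_nonneg hb p]

lemma IsSobolevPair.toReal_eLpNorm_le_sobolevNorm (hΩ : IsOpen Ω) (hp : 1 < p)
    (H : IsSobolevPair Ω (ENNReal.ofReal p) u g) :
    (eLpNorm u (ENNReal.ofReal p) (volume.restrict Ω)).toReal ≤ sobolevNorm Ω p u := by
  rw [H.sobolevNorm_eq hΩ hp]
  exact le_rpow_add_rpow hp ENNReal.toReal_nonneg ENNReal.toReal_nonneg

lemma IsSobolevPair.toReal_eLpNorm_grad_le_sobolevNorm (hΩ : IsOpen Ω) (hp : 1 < p)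
    (H : IsSobolevPair Ω (ENNReal.ofReal p) u g) :
    (eLpNorm g (ENNReal.ofReal p) (volume.restrict Ω)).toReal ≤ sobolevNorm Ω p u := by
  rw [H.sobolevNorm_eq hΩ hp, add_comm]
  exact le_rpow_add_rpow hp ENNReal.toReal_nonneg ENNReal.toReal_nonneg

/-- The cap `min ε 1` keeps the threshold finite: `toReal` would send `ε = ∞` to `0`. -/
lemma IsSobolevPair.eLpNorm_le_of_sobolevNorm_lt (hΩ : IsOpen Ω) (hp : 1 < p)
    (H : IsSobolevPair Ω (ENNReal.ofReal p) u g) {ε : ℝ≥0∞}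
    (hε : sobolevNorm Ω p u < (min ε 1).toReal) :
    eLpNorm u (ENNReal.ofReal p) (volume.restrict Ω) ≤ ε ∧
      eLpNorm g (ENNReal.ofReal p) (volume.restrict Ω) ≤ ε := by
  have ht : min ε 1 ≠ ⊤ := (min_lt_of_right_lt ENNReal.one_lt_top).ne
  constructor
  · refine le_trans ?_ (min_le_left ε 1)
    rw [← ENNReal.toReal_le_toReal H.memLp.2.ne ht]
    exact (H.toReal_eLpNorm_le_sobolevNorm hΩ hp).trans hε.le
  · refine le_trans ?_ (min_le_left ε 1)
    rw [← ENNReal.toReal_le_toReal H.memLp_grad.2.ne ht]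
    exact (H.toReal_eLpNorm_grad_le_sobolevNorm hΩ hp).trans hε.le

lemma eLpNorm_indicator_sub {F : Type*} [NormedAddCommGroup F] (hΩ : IsOpen Ω) {f φ : Eu N → F}
    (hφ : ∀ x ∉ Ω, φ x = 0) (q : ℝ≥0∞) :
    eLpNorm (Ω.indicator f - φ) q volume = eLpNorm (f - φ) q (volume.restrict Ω) := by
  rw [← eLpNorm_indicator_eq_eLpNorm_restrict hΩ.measurableSet]
  congr 1
  ext x
  by_cases hx : x ∈ Ω
  · simp [hx]
  · simp [hx, hφ x hx]

/-- Membership in `W_0^{1,p}(Ω)` in terms of the extension by zero. -/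
lemma IsSobolevPair.mem_sobolevWZero_iff (hΩ : IsOpen Ω) (hp : 1 < p)
    (H : IsSobolevPair Ω (ENNReal.ofReal p) u g) :
    u ∈ SobolevWZero Ω p ↔
      ApproxByTest Ω (ENNReal.ofReal p) (Ω.indicator u) (Ω.indicator g) := by
  constructor
  · rintro ⟨-, h2⟩ ε hε
    have hε' : 0 < (min ε 1).toReal := by
      refine ENNReal.toReal_pos ?_ (min_lt_of_right_lt ENNReal.one_lt_top).ne
      simp [hε]
    obtain ⟨v, ⟨φ, h1, h2, h3, hv⟩, hlt⟩ := h2 _ hε'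
    have hφ : IsTest Ω φ := ⟨h1, h2, h3⟩
    have Hv : IsSobolevPair Ω (ENNReal.ofReal p) v (gradient φ) :=
      (IsSobolevPair.of_isTest hφ).congr_ae hv.symm (ae_eq_refl _)
    obtain ⟨e1, e2⟩ := (H.coe_sub Hv).eLpNorm_le_of_sobolevNorm_lt hΩ hp hlt
    refine ⟨φ, hφ, ?_, ?_⟩
    · rw [eLpNorm_indicator_sub hΩ fun x hx => hφ.eq_zero hx]
      refine (eLpNorm_congr_ae ?_).trans_le e1
      exact ((ae_eq_refl _).sub hv.symm).trans (AEEqFun.coeFn_sub u v).symm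
    · rwa [eLpNorm_indicator_sub hΩ fun x hx => hφ.gradient_eq_zero hx]
  · intro h
    refine ⟨mem_sobolevW_iff.2 ⟨g, H⟩, fun ε hε => ?_⟩
    -- The function and the gradient each cost `ε / 3`, and `2 ε / 3 < ε` gives the strict
    -- inequality.
    obtain ⟨φ, hφ, e1, e2⟩ := h (ENNReal.ofReal (ε / 3)) (by simpa using hε)
    rw [eLpNorm_indicator_sub hΩ fun x hx => hφ.eq_zero hx] at e1
    rw [eLpNorm_indicator_sub hΩ fun x hx => hφ.gradient_eq_zero hx] at e2
    set v : MeasFun Ω := AEEqFun.mk φ hφ.continuous.aestronglyMeasurable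
    have hv : v =ᵐ[volume.restrict Ω] φ := AEEqFun.coeFn_mk _ _
    have Hv : IsSobolevPair Ω (ENNReal.ofReal p) v (gradient φ) :=
      (IsSobolevPair.of_isTest hφ).congr_ae hv.symm (ae_eq_refl _)
    refine ⟨v, ⟨φ, hφ.1, hφ.2, hφ.3, hv⟩, ((H.coe_sub Hv).sobolevNorm_le hΩ hp).trans_lt ?_⟩
    have e1' : eLpNorm (u - v : MeasFun Ω) (ENNReal.ofReal p) (volume.restrict Ω) ≤
        ENNReal.ofReal (ε / 3) := by
      refine (eLpNorm_congr_ae ?_).trans_le e1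
      exact (AEEqFun.coeFn_sub u v).trans ((ae_eq_refl _).sub hv)
    have a1 := ENNReal.toReal_le_of_le_ofReal (by positivity) e1'
    have a2 := ENNReal.toReal_le_of_le_ofReal (by positivity) e2
    linarith

end transfer

/-! ### Membership in `W_0^{1,p_-}(Ω)` -/

section zeroMinus

variable {N : ℕ} {Ω : Set (Eu N)} {p : ℝ} {u v : MeasFun Ω} {g h : Eu N → Eu N}

lemma eLpNorm_le_eLpNorm_mul_of_eq_zero {F : Type*} [NormedAddCommGroup F] {f : Eu N → F}
    {r s : ℝ≥0∞} (hΩ : IsOpen Ω) (hrs : r ≤ s)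
    (hf : AEStronglyMeasurable f volume) (hf0 : ∀ x ∉ Ω, f x = 0) :
    eLpNorm f r volume ≤ eLpNorm f s volume * volume Ω ^ (1 / r.toReal - 1 / s.toReal) := by
  have e : ∀ t, eLpNorm f t volume = eLpNorm f t (volume.restrict Ω) := by
    intro t
    rw [← eLpNorm_indicator_eq_eLpNorm_restrict hΩ.measurableSet]
    congr 1
    ext x
    by_cases hx : x ∈ Ω
    · simp [hx]
    · simp [hx, hf0 x hx]
  rw [e, e]
  simpa using eLpNorm_le_eLpNorm_mul_rpow_measure_univ hrs (hf.restrict (s := Ω))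

lemma ApproxByTest.mono_exponent {r s : ℝ≥0∞} (hr : 1 ≤ r) (hs : s ≠ ⊤) (hΩ : IsOpen Ω)
    (hΩb : Bornology.IsBounded Ω) (hrs : r ≤ s) {f : Eu N → ℝ} {g : Eu N → Eu N}
    (mf : AEStronglyMeasurable f volume) (mg : AEStronglyMeasurable g volume)
    (hf0 : ∀ x ∉ Ω, f x = 0) (hg0 : ∀ x ∉ Ω, g x = 0) (H : ApproxByTest Ω s f g) :
    ApproxByTest Ω r f g := by
  intro ε hε
  set D : ℝ≥0∞ := volume Ω ^ (1 / r.toReal - 1 / s.toReal)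
  have hD : D ≠ ⊤ := by
    refine ENNReal.rpow_ne_top_of_nonneg ?_ hΩb.measure_lt_top.ne
    have hr' : r ≠ ⊤ := ne_top_of_le_ne_top hs hrs
    have h1 : 0 < r.toReal := ENNReal.toReal_pos (one_pos.trans_le hr).ne' hr'
    have h2 : r.toReal ≤ s.toReal := ENNReal.toReal_mono hs hrs
    have := one_div_le_one_div_of_le h1 h2
    linarith
  -- The Hölder constant `D` can be `0` when `Ω` is empty; then `ε / D = ∞`, and
  -- `ENNReal.mul_div_le` still applies.
  obtain ⟨φ, hφ, h1, h2⟩ := H (ε / D) (ENNReal.div_ne_zero.2 ⟨hε, hD⟩)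
  refine ⟨φ, hφ, ?_, ?_⟩
  · refine (eLpNorm_le_eLpNorm_mul_of_eq_zero hΩ hrs
      (mf.sub hφ.continuous.aestronglyMeasurable) fun x hx => ?_).trans ?_
    · simp [hf0 x hx, hφ.eq_zero hx]
    · rw [mul_comm]
      exact (mul_le_mul_right h1 _).trans ENNReal.mul_div_le
  · refine (eLpNorm_le_eLpNorm_mul_of_eq_zero hΩ hrs
      (mg.sub (hφ.memLp_gradient r _).1) fun x hx => ?_).trans ?_
    · simp [hg0 x hx, hφ.gradient_eq_zero hx]
    · rw [mul_comm]
      exact (mul_le_mul_right h2 _).trans ENNReal.mul_div_le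

lemma IsSobolevPair.aestronglyMeasurable_indicator {q : ℝ≥0∞} (hΩ : IsOpen Ω) {u : Eu N → ℝ}
    (H : IsSobolevPair Ω q u g) :
    AEStronglyMeasurable (Ω.indicator u) volume ∧ AEStronglyMeasurable (Ω.indicator g) volume :=
  ⟨(aestronglyMeasurable_indicator_iff hΩ.measurableSet).2 H.memLp.1,
    (aestronglyMeasurable_indicator_iff hΩ.measurableSet).2 H.memLp_grad.1⟩

lemma IsSobolevPair.memLp_indicator {q : ℝ≥0∞} (hΩ : IsOpen Ω) {u : Eu N → ℝ}
    (H : IsSobolevPair Ω q u g) :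
    MemLp (Ω.indicator u) q volume ∧ MemLp (Ω.indicator g) q volume :=
  ⟨(memLp_indicator_iff_restrict hΩ.measurableSet).2 H.memLp,
    (memLp_indicator_iff_restrict hΩ.measurableSet).2 H.memLp_grad⟩

/-- Since `Ω` is bounded, `W^{1,p}(Ω)` lies in every `W^{1,s}(Ω)` with `s < p`, so one gradient `g`
serves all exponents. -/
lemma IsSobolevPair.mem_sobolevWZeroMinus_iff (hΩ : IsOpen Ω) (hΩb : Bornology.IsBounded Ω)
    (H : IsSobolevPair Ω (ENNReal.ofReal p) u g) :
    u ∈ SobolevWZeroMinus Ω p ↔ ∀ s ∈ Ioo 1 p,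
      ApproxByTest Ω (ENNReal.ofReal s) (Ω.indicator u) (Ω.indicator g) := by
  have : ∀ s ∈ Ioo 1 p, (u ∈ SobolevWZero Ω s ↔
      ApproxByTest Ω (ENNReal.ofReal s) (Ω.indicator u) (Ω.indicator g)) := fun s hs =>
    (H.mono_exponent hΩb (ENNReal.ofReal_le_ofReal hs.2.le)).mem_sobolevWZero_iff hΩ hs.1
  rw [SobolevWZeroMinus, mem_inter_iff, mem_iInter₂]
  exact ⟨fun h s hs => (this s hs).1 (h.2 s hs),
    fun h => ⟨mem_sobolevW_iff.2 ⟨g, H⟩, fun s hs => (this s hs).2 (h s hs)⟩⟩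

lemma sobolevWZeroMinus_subset : SobolevWZeroMinus Ω p ⊆ SobolevW Ω p := inter_subset_left

lemma sobolevWZero_subset_sobolevWZeroMinus (hΩ : IsOpen Ω) (hΩb : Bornology.IsBounded Ω)
    (hp : 1 < p) : SobolevWZero Ω p ⊆ SobolevWZeroMinus Ω p := by
  intro u hu
  obtain ⟨g, H⟩ := mem_sobolevW_iff.1 hu.1
  refine (H.mem_sobolevWZeroMinus_iff hΩ hΩb).2 fun s hs => ?_
  obtain ⟨m1, m2⟩ := H.aestronglyMeasurable_indicator hΩ
  exact ((H.mem_sobolevWZero_iff hΩ hp).1 hu).mono_exponent (one_le_ofReal_of_lt hs.1) (by simp)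
    hΩ hΩb (ENNReal.ofReal_le_ofReal hs.2.le) m1 m2 (fun x hx => indicator_of_notMem hx _)
    (fun x hx => indicator_of_notMem hx _)

end zeroMinus

/-! ### Part (a): a closed subspace -/

section partA

variable {N : ℕ} {Ω : Set (Eu N)} {p : ℝ} {u v : MeasFun Ω} {g h : Eu N → Eu N}

lemma sobolevWZeroMinus_add (hΩ : IsOpen Ω) (hΩb : Bornology.IsBounded Ω)
    (hu : u ∈ SobolevWZeroMinus Ω p) (hv : v ∈ SobolevWZeroMinus Ω p) :
    u + v ∈ SobolevWZeroMinus Ω p := by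
  obtain ⟨g, H⟩ := mem_sobolevW_iff.1 hu.1
  obtain ⟨h, H'⟩ := mem_sobolevW_iff.1 hv.1
  have hu := (H.mem_sobolevWZeroMinus_iff hΩ hΩb).1 hu
  have hv := (H'.mem_sobolevWZeroMinus_iff hΩ hΩb).1 hv
  refine ((H.coe_add H').mem_sobolevWZeroMinus_iff hΩ hΩb).2 fun s hs => ?_
  obtain ⟨m1, m2⟩ := H.aestronglyMeasurable_indicator hΩ
  obtain ⟨m3, m4⟩ := H'.aestronglyMeasurable_indicator hΩ
  refine ((hu s hs).add (one_le_ofReal_of_lt hs.1) m1 m2 m3 m4 (hv s hs)).congr_ae ?_ ?_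
  · rw [← indicator_add']
    exact (ae_eq_restrict_iff_indicator_ae_eq hΩ.measurableSet).1 (AEEqFun.coeFn_add u v).symm
  · rw [← indicator_add']

lemma sobolevWZeroMinus_smul (hΩ : IsOpen Ω) (hΩb : Bornology.IsBounded Ω) (c : ℝ)
    (hu : u ∈ SobolevWZeroMinus Ω p) : c • u ∈ SobolevWZeroMinus Ω p := by
  obtain ⟨g, H⟩ := mem_sobolevW_iff.1 hu.1
  have hu := (H.mem_sobolevWZeroMinus_iff hΩ hΩb).1 hu
  refine ((H.coe_smul c).mem_sobolevWZeroMinus_iff hΩ hΩb).2 fun s hs => ?_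
  refine ((hu s hs).const_smul c).congr_ae ?_ ?_
  · rw [show c • Ω.indicator u = Ω.indicator (c • (u : Eu N → ℝ)) from
      (indicator_const_smul Ω c u).symm]
    exact (ae_eq_restrict_iff_indicator_ae_eq hΩ.measurableSet).1 (AEEqFun.coeFn_smul c u).symm
  · rw [show c • Ω.indicator g = Ω.indicator (c • g) from (indicator_const_smul Ω c g).symm]

lemma zero_mem_sobolevWZeroMinus (hΩ : IsOpen Ω) (hΩb : Bornology.IsBounded Ω) :
    (0 : MeasFun Ω) ∈ SobolevWZeroMinus Ω p := by
  have h0 : (0 : Eu N → ℝ) =ᵐ[volume.restrict Ω] (0 : MeasFun Ω) := AEEqFun.coeFn_zero.symm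
  have H : IsSobolevPair Ω (ENNReal.ofReal p) (0 : MeasFun Ω) 0 := by
    have := (IsSobolevPair.of_isTest (p := ENNReal.ofReal p) (Ω := Ω) (IsTest.zero (Ω := Ω)))
    rw [gradient_zero] at this
    exact this.congr_ae h0 (ae_eq_refl _)
  refine (H.mem_sobolevWZeroMinus_iff hΩ hΩb).2 fun s _ => ApproxByTest.zero.congr_ae ?_ ?_
  · have := (ae_eq_restrict_iff_indicator_ae_eq hΩ.measurableSet).1 h0
    rwa [indicator_zero'] at this
  · rw [indicator_zero']

/-- `W_0^{1,p_-}(Ω)` as a linear subspace. -/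
def sobolevWZeroMinusSubmodule (hΩ : IsOpen Ω) (hΩb : Bornology.IsBounded Ω) (p : ℝ) :
    Submodule ℝ (MeasFun Ω) where
  carrier := SobolevWZeroMinus Ω p
  zero_mem' := zero_mem_sobolevWZeroMinus hΩ hΩb
  add_mem' := sobolevWZeroMinus_add hΩ hΩb
  smul_mem' c _ := sobolevWZeroMinus_smul hΩ hΩb c

lemma eLpNorm_indicator_sub_self_set {F : Type*} [NormedAddCommGroup F] (hΩ : IsOpen Ω)
    (a b : Eu N → F) (q : ℝ≥0∞) :
    eLpNorm (Ω.indicator a - Ω.indicator b) q volume = eLpNorm (a - b) q (volume.restrict Ω) := by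
  rw [← indicator_sub', eLpNorm_indicator_eq_eLpNorm_restrict hΩ.measurableSet]

/-- By Hölder on `Ω`, closeness in `W^{1,p}` implies closeness in each `W^{1,s}`, where limits of
test functions are closed under limits. -/
lemma sobolevClosure_sobolevWZeroMinus_subset (hΩ : IsOpen Ω) (hΩb : Bornology.IsBounded Ω)
    (hp : 1 < p) : sobolevClosure Ω p (SobolevWZeroMinus Ω p) ⊆ SobolevWZeroMinus Ω p := by
  rintro u ⟨hu, hcl⟩
  obtain ⟨g, H⟩ := mem_sobolevW_iff.1 hu
  obtain ⟨m1, m2⟩ := H.aestronglyMeasurable_indicator hΩ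
  refine (H.mem_sobolevWZeroMinus_iff hΩ hΩb).2 fun s hs => ?_
  have hs1 := one_le_ofReal_of_lt hs.1
  have hsp : ENNReal.ofReal s ≤ ENNReal.ofReal p := ENNReal.ofReal_le_ofReal hs.2.le
  refine ApproxByTest.of_approx hs1 m1 m2 fun ε hε => ?_
  set D : ℝ≥0∞ := volume Ω ^ (1 / (ENNReal.ofReal s).toReal - 1 / (ENNReal.ofReal p).toReal)
  have hD : D ≠ ⊤ := by
    refine ENNReal.rpow_ne_top_of_nonneg ?_ hΩb.measure_lt_top.ne
    rw [toReal_ofReal_of_lt hs.1, toReal_ofReal_of_lt hp]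
    have := one_div_le_one_div_of_le (one_pos.trans hs.1) hs.2.le
    linarith
  have hε' : 0 < (min (ε / D) 1).toReal := by
    refine ENNReal.toReal_pos ?_ (min_lt_of_right_lt ENNReal.one_lt_top).ne
    simp [hε, hD, ENNReal.div_eq_zero_iff]
  obtain ⟨v, hv, hlt⟩ := hcl _ hε'
  obtain ⟨h, H'⟩ := mem_sobolevW_iff.1 hv.1
  obtain ⟨m3, m4⟩ := H'.aestronglyMeasurable_indicator hΩ
  obtain ⟨e1, e2⟩ := (H.coe_sub H').eLpNorm_le_of_sobolevNorm_lt hΩ hp hlt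
  rw [eLpNorm_congr_ae (AEEqFun.coeFn_sub u v)] at e1
  refine ⟨Ω.indicator v, Ω.indicator h, m3, m4,
    (H'.mem_sobolevWZeroMinus_iff hΩ hΩb).1 hv s hs, ?_, ?_⟩
  · refine (eLpNorm_le_eLpNorm_mul_of_eq_zero hΩ hsp (m1.sub m3) fun x hx => ?_).trans ?_
    · simp [hx]
    · rw [mul_comm, eLpNorm_indicator_sub_self_set hΩ]
      exact (mul_le_mul_right e1 _).trans ENNReal.mul_div_le
  · refine (eLpNorm_le_eLpNorm_mul_of_eq_zero hΩ hsp (m2.sub m4) fun x hx => ?_).trans ?_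
    · simp [hx]
    · rw [mul_comm, eLpNorm_indicator_sub_self_set hΩ]
      exact (mul_le_mul_right e2 _).trans ENNReal.mul_div_le

end partA

/-! ### Part (b): extension by zero and the gradient norm -/

section extension

variable {N : ℕ} {Ω : Set (Eu N)} {p : ℝ} {u v : MeasFun Ω} {g h : Eu N → Eu N}

/-- The extension by zero of a function in `W_0^{1,p_-}(Ω)` is in `W^{1,p}(ℝ^N)`. -/
lemma IsSobolevPair.extend (hΩ : IsOpen Ω) (hΩb : Bornology.IsBounded Ω) (hp : 1 < p)
    (H : IsSobolevPair Ω (ENNReal.ofReal p) u g) (hu : u ∈ SobolevWZeroMinus Ω p) :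
    IsSobolevPair univ (ENNReal.ofReal p) (Ω.indicator u) (Ω.indicator g) := by
  obtain ⟨m1, m2⟩ := H.memLp_indicator hΩ
  -- A single exponent below `p` suffices to identify the weak gradient; integrability at exponent
  -- `p` is already known from `H`.
  have hs : (1 + p) / 2 ∈ Ioo 1 p := ⟨by linarith, by linarith⟩
  have Hs := H.mono_exponent hΩb (ENNReal.ofReal_le_ofReal hs.2.le)
  obtain ⟨n1, n2⟩ := Hs.memLp_indicator hΩ
  refine ⟨m1.restrict _, ?_, m2.restrict _⟩
  exact ((H.mem_sobolevWZeroMinus_iff hΩ hΩb).1 hu _ hs).hasWeakGradient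
    (one_le_ofReal_of_lt hs.1) n1 n2

/-- The extension is in `W^{1,p}(ℝ^N)` with support in the compact set `closure Ω`. Mollifying
recovers approximation at the exponent `p` itself, at the price of leaving `Ω` slightly. -/
lemma IsSobolevPair.approxByTest_extend (hΩ : IsOpen Ω) (hΩb : Bornology.IsBounded Ω) (hp : 1 < p)
    (H : IsSobolevPair Ω (ENNReal.ofReal p) u g) (hu : u ∈ SobolevWZeroMinus Ω p)
    {Ω' : Set (Eu N)} (hΩ' : IsOpen Ω') (hcl : closure Ω ⊆ Ω') :
    ApproxByTest Ω' (ENNReal.ofReal p) (Ω.indicator u) (Ω.indicator g) := by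
  obtain ⟨m1, m2⟩ := H.memLp_indicator hΩ
  exact (H.extend hΩ hΩb hp hu).hasWeakGradient.approxByTest hΩ' hΩb.isCompact_closure hcl
    (one_le_ofReal_of_lt hp) (by simp) m1 m2
    fun x hx => indicator_of_notMem (fun h => hx (subset_closure h)) _

/-- The Poincaré inequality in `W_0^{1,p_-}(Ω)`. -/
lemma exists_poincare (hN : 1 ≤ N) (hΩ : IsOpen Ω) (hΩb : Bornology.IsBounded Ω) (hp : 1 < p) :
    ∃ C : ℝ≥0∞, C ≠ ⊤ ∧ ∀ (u : MeasFun Ω) (g : Eu N → Eu N),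
      IsSobolevPair Ω (ENNReal.ofReal p) u g → u ∈ SobolevWZeroMinus Ω p →
      eLpNorm u (ENNReal.ofReal p) (volume.restrict Ω) ≤
        C * eLpNorm g (ENNReal.ofReal p) (volume.restrict Ω) := by
  -- The approximants live in a ball around `closure Ω`, which is all that the Poincaré inequality
  -- asks.
  obtain ⟨R, hR, hsub⟩ := hΩb.closure.subset_ball_lt 0 0
  refine ⟨ENNReal.ofReal (2 * R + 1), ENNReal.ofReal_ne_top, fun u g H hu => ?_⟩
  obtain ⟨m1, m2⟩ := H.memLp_indicator hΩ
  have h1 := (H.approxByTest_extend hΩ hΩb hp hu Metric.isOpen_ball hsub).eLpNorm_le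
    (q := ENNReal.ofReal p) (C := ENNReal.ofReal (2 * R + 1)) ENNReal.ofReal_ne_top
    (one_le_ofReal_of_lt hp) m1 m2
    fun φ hφ => poincare_isTest hN (one_le_ofReal_of_lt hp) (by simp) hR.le
      (hφ.mono Metric.ball_subset_closedBall)
  rwa [eLpNorm_indicator_eq_eLpNorm_restrict hΩ.measurableSet,
    eLpNorm_indicator_eq_eLpNorm_restrict hΩ.measurableSet] at h1

/-- Definiteness is the Poincaré inequality; the other axioms are inherited from the `L^p` norm of
the gradient. -/
lemma isNormOn_gradNorm (hN : 1 ≤ N) (hΩ : IsOpen Ω) (hΩb : Bornology.IsBounded Ω) (hp : 1 < p) :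
    IsNormOn (SobolevWZeroMinus Ω p) (gradNorm Ω p) := by
  obtain ⟨C, -, hC⟩ := exists_poincare hN hΩ hΩb hp
  refine ⟨fun u hu => ?_, fun u hu => ?_, fun c u hu => ?_, fun u hu v hv => ?_⟩
  · obtain ⟨g, H⟩ := mem_sobolevW_iff.1 hu.1
    rw [H.gradNorm_eq hΩ hp]
    exact ENNReal.toReal_nonneg
  · obtain ⟨g, H⟩ := mem_sobolevW_iff.1 hu.1
    constructor
    · intro h0
      rw [H.gradNorm_eq hΩ hp, ENNReal.toReal_eq_zero_iff, or_iff_left H.memLp_grad.2.ne] at h0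
      have h1 := hC u g H hu
      rw [h0, mul_zero, nonpos_iff_eq_zero, eLpNorm_eq_zero_iff H.memLp.1
        (one_pos.trans_le (one_le_ofReal_of_lt hp)).ne'] at h1
      exact AEEqFun.ext (h1.trans AEEqFun.coeFn_zero.symm)
    · rintro rfl
      have h0 := H.coe_smul 0
      rw [zero_smul, zero_smul] at h0
      rw [h0.gradNorm_eq hΩ hp]
      simp
  · obtain ⟨g, H⟩ := mem_sobolevW_iff.1 hu.1
    rw [(H.coe_smul c).gradNorm_eq hΩ hp, H.gradNorm_eq hΩ hp, eLpNorm_const_smul,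
      ENNReal.toReal_mul, toReal_enorm, Real.norm_eq_abs]
  · obtain ⟨g, H⟩ := mem_sobolevW_iff.1 hu.1
    obtain ⟨h, H'⟩ := mem_sobolevW_iff.1 hv.1
    rw [(H.coe_add H').gradNorm_eq hΩ hp, H.gradNorm_eq hΩ hp, H'.gradNorm_eq hΩ hp,
      ← ENNReal.toReal_add H.memLp_grad.2.ne H'.memLp_grad.2.ne]
    exact ENNReal.toReal_mono (ENNReal.add_ne_top.2 ⟨H.memLp_grad.2.ne, H'.memLp_grad.2.ne⟩)
      (eLpNorm_add_le H.memLp_grad.1 H'.memLp_grad.1 (one_le_ofReal_of_lt hp))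

lemma exists_gradNorm_equiv (hN : 1 ≤ N) (hΩ : IsOpen Ω) (hΩb : Bornology.IsBounded Ω)
    (hp : 1 < p) : ∃ c > 0, ∃ C > 0, ∀ u ∈ SobolevWZeroMinus Ω p,
      c * sobolevNorm Ω p u ≤ gradNorm Ω p u ∧ gradNorm Ω p u ≤ C * sobolevNorm Ω p u := by
  obtain ⟨C, hCt, hC⟩ := exists_poincare hN hΩ hΩb hp
  have hC0 : 0 ≤ C.toReal := ENNReal.toReal_nonneg
  -- The full norm is at most `‖u‖_p + ‖∇u‖_p`, hence at most `(C + 1) ‖∇u‖_p`.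
  refine ⟨(C.toReal + 1)⁻¹, by positivity, 1, one_pos, fun u hu => ?_⟩
  obtain ⟨g, H⟩ := mem_sobolevW_iff.1 hu.1
  rw [H.gradNorm_eq hΩ hp]
  constructor
  · rw [inv_mul_le_iff₀ (by positivity)]
    have h1 := ENNReal.toReal_mono (ENNReal.mul_ne_top hCt H.memLp_grad.2.ne) (hC u g H hu)
    rw [ENNReal.toReal_mul] at h1
    linarith [H.sobolevNorm_le hΩ hp]
  · rw [one_mul]
    exact H.toReal_eLpNorm_grad_le_sobolevNorm hΩ hp

end extension

/-! ### Part (c): the critical exponent and the best Sobolev constant -/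

section criticalExponent

variable {N : ℕ} {p : ℝ}

lemma inv_criticalExponent (hp : 1 < p) (hpN : p < N) :
    (criticalExponent N p)⁻¹ = p⁻¹ - (N : ℝ)⁻¹ := by
  have hp0 : p ≠ 0 := by linarith
  have hN0 : (N : ℝ) ≠ 0 := by linarith
  rw [criticalExponent, inv_div]
  field_simp

lemma one_lt_criticalExponent (hp : 1 < p) (hpN : p < N) : 1 < criticalExponent N p := by
  rw [criticalExponent, one_lt_div (by linarith)]
  nlinarith

end criticalExponent

section sobolev

variable {N : ℕ} {Ω : Set (Eu N)} {p : ℝ} {u v : MeasFun Ω} {g h : Eu N → Eu N}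

lemma IsTest.approxByTest {Ω : Set (Eu N)} {φ : Eu N → ℝ} (hφ : IsTest Ω φ) (q : ℝ≥0∞) :
    ApproxByTest Ω q φ (gradient φ) := fun ε _ => ⟨φ, hφ, by simp, by simp⟩

lemma IsSobolevPair.memLp_criticalExponent (hN : 1 ≤ N) (hΩ : IsOpen Ω)
    (hΩb : Bornology.IsBounded Ω) (hp : 1 < p) (hpN : p < N)
    (H : IsSobolevPair Ω (ENNReal.ofReal p) u g) (hu : u ∈ SobolevWZeroMinus Ω p) :
    MemLp u (ENNReal.ofReal (criticalExponent N p)) (volume.restrict Ω) := by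
  obtain ⟨C, hC, HC⟩ := exists_sobolev_isTest hN hp.le (inv_criticalExponent hp hpN)
    (zero_le_one.trans (one_lt_criticalExponent hp hpN).le)
  obtain ⟨m1, m2⟩ := H.memLp_indicator hΩ
  have h1 := (H.approxByTest_extend hΩ hΩb hp hu isOpen_univ (subset_univ _)).eLpNorm_le hC
    (one_le_ofReal_of_lt hp) m1 m2 HC
  rw [eLpNorm_indicator_eq_eLpNorm_restrict hΩ.measurableSet] at h1
  exact ⟨H.memLp.1, h1.trans_lt (ENNReal.mul_lt_top hC.lt_top m2.2)⟩

lemma IsSobolevPair.sobolevQuotient_eq (hΩ : IsOpen Ω) (hp : 1 < p) (hpN : p < N)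
    (H : IsSobolevPair Ω (ENNReal.ofReal p) u g)
    (hu : MemLp u (ENNReal.ofReal (criticalExponent N p)) (volume.restrict Ω)) :
    sobolevQuotient Ω p u = ((eLpNorm g (ENNReal.ofReal p) (volume.restrict Ω)).toReal /
      (eLpNorm u (ENNReal.ofReal (criticalExponent N p)) (volume.restrict Ω)).toReal) ^ p := by
  have hq := one_lt_criticalExponent hp hpN
  have h1 := integral_norm_rpow_eq hq hu
  simp only [Real.norm_eq_abs] at h1
  rw [sobolevQuotient, H.integral_weakGradient hΩ hp, h1, ← Real.rpow_mul ENNReal.toReal_nonneg,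
    mul_div_cancel₀ _ (by linarith : criticalExponent N p ≠ 0),
    Real.div_rpow ENNReal.toReal_nonneg ENNReal.toReal_nonneg]

lemma tendsto_toReal_eLpNorm {α F : Type*} [MeasurableSpace α] {μ : Measure α}
    [NormedAddCommGroup F] {q : ℝ≥0∞} (hq : 1 ≤ q) {φ : ℕ → α → F} {f : α → F}
    (hφ : ∀ n, MemLp (φ n) q μ) (hf : MemLp f q μ)
    (h : Tendsto (fun n => eLpNorm (φ n - f) q μ) atTop (𝓝 0)) :
    Tendsto (fun n => (eLpNorm (φ n) q μ).toReal) atTop (𝓝 (eLpNorm f q μ).toReal) := by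
  have h' : Tendsto (fun n => (eLpNorm (φ n - f) q μ).toReal) atTop (𝓝 0) := by
    simpa [Function.comp_def] using (ENNReal.tendsto_toReal ENNReal.zero_ne_top).comp h
  rw [tendsto_iff_dist_tendsto_zero]
  refine squeeze_zero (fun _ => dist_nonneg) (fun n => ?_) h'
  have hd := (hφ n).sub hf
  rw [Real.dist_eq, abs_sub_le_iff]
  constructor
  · have := ENNReal.toReal_mono (ENNReal.add_ne_top.2 ⟨hd.2.ne, hf.2.ne⟩)
      (eLpNorm_add_le hd.1 hf.1 hq)
    rw [sub_add_cancel, ENNReal.toReal_add hd.2.ne hf.2.ne] at this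
    linarith
  · have := ENNReal.toReal_mono (ENNReal.add_ne_top.2 ⟨(hφ n).2.ne, hd.2.ne⟩)
      (eLpNorm_sub_le (hφ n).1 hd.1 hq)
    rw [sub_sub_cancel, ENNReal.toReal_add (hφ n).2.ne hd.2.ne] at this
    linarith

lemma IsTest.mk_mem_sobolevWZero (hΩ : IsOpen Ω) (hp : 1 < p) {φ : Eu N → ℝ} (hφ : IsTest Ω φ) :
    (AEEqFun.mk φ hφ.continuous.aestronglyMeasurable : MeasFun Ω) ∈ SobolevWZero Ω p ∧
    IsSobolevPair Ω (ENNReal.ofReal p)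
      (AEEqFun.mk φ hφ.continuous.aestronglyMeasurable : MeasFun Ω) (gradient φ) := by
  have hv := AEEqFun.coeFn_mk φ (hφ.continuous.aestronglyMeasurable (μ := volume.restrict Ω))
  have H : IsSobolevPair Ω (ENNReal.ofReal p)
      (AEEqFun.mk φ hφ.continuous.aestronglyMeasurable : MeasFun Ω) (gradient φ) :=
    (IsSobolevPair.of_isTest hφ).congr_ae hv.symm (ae_eq_refl _)
  refine ⟨(H.mem_sobolevWZero_iff hΩ hp).2 ((hφ.approxByTest _).congr_ae ?_ ?_), H⟩
  · have h1 : Ω.indicator φ = φ := indicator_eq_self.2 fun x hx => by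
      by_contra h
      exact hx (hφ.eq_zero h)
    have := (ae_eq_restrict_iff_indicator_ae_eq hΩ.measurableSet).1 hv.symm
    rwa [h1] at this
  · have h1 : Ω.indicator (gradient φ) = gradient φ := indicator_eq_self.2 fun x hx => by
      by_contra h
      exact hx (hφ.gradient_eq_zero h)
    rw [h1]

/-- A test function can be rescaled into any open set without changing its Sobolev quotient. -/
lemma IsTest.exists_rescale (hΩ : IsOpen Ω) (hne : Ω.Nonempty) (hp : 1 < p) (hpN : p < N)
    {φ : Eu N → ℝ} (hφ : IsTest univ φ) :
    ∃ ψ, IsTest Ω ψ ∧ ∃ c : ℝ≥0∞, c ≠ 0 ∧ c ≠ ⊤ ∧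
      eLpNorm ψ (ENNReal.ofReal (criticalExponent N p)) volume =
        c * eLpNorm φ (ENNReal.ofReal (criticalExponent N p)) volume ∧
      eLpNorm (gradient ψ) (ENNReal.ofReal p) volume =
        c * eLpNorm (gradient φ) (ENNReal.ofReal p) volume := by
  obtain ⟨x₀, hx₀⟩ := hne
  obtain ⟨r, hr, hrΩ⟩ := Metric.isOpen_iff.1 hΩ x₀ hx₀
  obtain ⟨R, hR, hRφ⟩ := hφ.hasCompactSupport.isCompact.isBounded.subset_closedBall_lt 0 0
  have hq := one_lt_criticalExponent hp hpN
  -- The dilation takes the ball of radius `R` containing the support of `φ` to the ball of radius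
  -- `r / 2` about `x₀`.
  set t : ℝ := 2 * R / r with ht
  have ht0 : 0 < t := by positivity
  set ψ : Eu N → ℝ := fun x => φ (t • (x - x₀)) with hψ
  have hgr : gradient ψ = fun x => t • gradient φ (t • (x - x₀)) := by
    ext1 x
    have h1 : HasFDerivAt (fun x : Eu N => t • (x - x₀)) (t • ContinuousLinearMap.id ℝ (Eu N)) x :=
      ((hasFDerivAt_id x).sub_const x₀).const_smul t
    have h2 := (hφ.differentiable (t • (x - x₀))).hasFDerivAt.comp x h1
    have h3 : fderiv ℝ ψ x = t • fderiv ℝ φ (t • (x - x₀)) := by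
      rw [show ψ = φ ∘ fun x : Eu N => t • (x - x₀) from rfl, h2.fderiv]
      ext v
      simp
    rw [gradient, h3, gradient]
    simp
  have hsupp : tsupport ψ ⊆ Metric.closedBall x₀ (r / 2) := by
    refine closure_minimal (fun x hx => ?_) Metric.isClosed_closedBall
    have h1 := hRφ (subset_tsupport φ hx)
    rw [mem_closedBall_zero_iff, norm_smul, Real.norm_of_nonneg ht0.le] at h1
    rw [Metric.mem_closedBall, dist_eq_norm]
    have h2 : t * ‖x - x₀‖ ≤ t * (r / 2) := by
      refine h1.trans (le_of_eq ?_)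
      rw [ht]
      field_simp
    exact le_of_mul_le_mul_left h2 ht0
  have htrans : ∀ {F : Type} [NormedAddCommGroup F] (G : Eu N → F) (hG : Continuous G)
      (s : ℝ≥0∞) (_ : s ≠ ⊤), eLpNorm (fun x => G (t • (x - x₀))) s volume =
        ENNReal.ofReal (t ^ (-(N : ℝ) * (s.toReal)⁻¹)) * eLpNorm G s volume := by
    intro F _ G hG s hs
    rw [← eLpNorm_comp_smul hs hG ht0]
    have hc : Continuous fun y => G (t • y) := hG.comp (by fun_prop)
    exact eLpNorm_comp_measurePreserving hc.aestronglyMeasurable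
      (measurePreserving_sub_right volume x₀)
  refine ⟨ψ, ⟨hφ.contDiff.comp (by fun_prop), ?_, ?_⟩,
    ENNReal.ofReal (t ^ (-(N : ℝ) * (criticalExponent N p)⁻¹)), ?_, ENNReal.ofReal_ne_top, ?_, ?_⟩
  · exact (isCompact_closedBall x₀ (r / 2)).of_isClosed_subset (isClosed_tsupport _) hsupp
  · exact hsupp.trans ((Metric.closedBall_subset_ball (by linarith)).trans hrΩ)
  · simpa using Real.rpow_pos_of_pos ht0 _
  · rw [hψ, htrans φ hφ.continuous _ ENNReal.ofReal_ne_top, toReal_ofReal_of_lt hq]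
  · have h1 := eLpNorm_const_smul t (fun x => gradient φ (t • (x - x₀))) (ENNReal.ofReal p) volume
    rw [hgr, show (fun x => t • gradient φ (t • (x - x₀))) =
      t • fun x => gradient φ (t • (x - x₀)) from rfl, h1,
      htrans _ (continuous_gradient hφ.contDiff_one) _ ENNReal.ofReal_ne_top,
      toReal_ofReal_of_lt hp, ← mul_assoc]
    congr 1
    -- The gradient contributes an extra factor `t`, and `1 - N / p = -N / p^*`; both norms
    -- therefore scale by the same `c`.
    rw [Real.enorm_eq_ofReal ht0.le, ← ENNReal.ofReal_mul ht0.le, inv_criticalExponent hp hpN]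
    congr 1
    have hN0 : (N : ℝ) ≠ 0 := by linarith
    conv_lhs => rw [← Real.rpow_one t, ← Real.rpow_mul ht0.le, one_mul, ← Real.rpow_add ht0]
    congr 1
    field_simp
    ring

/-- Only one inequality is not inclusion. Given `u`, test functions of `ℝ^N` approximate its
extension in both norms of the quotient, so their quotients converge to that of `u`. Each of these
quotients is also attained by a test function of `Ω`, after rescaling. -/
lemma iInf_sobolevQuotient_eq (hN : 1 ≤ N) (hΩ : IsOpen Ω) (hΩb : Bornology.IsBounded Ω)
    (hp : 1 < p) (hpN : p < N) :
    (⨅ u ∈ SobolevWZero Ω p \ {0}, (sobolevQuotient Ω p u : EReal)) =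
      ⨅ u ∈ SobolevWZeroMinus Ω p \ {0}, (sobolevQuotient Ω p u : EReal) := by
  have hq := one_lt_criticalExponent hp hpN
  have hq1 := one_le_ofReal_of_lt hq
  have hp1 := one_le_ofReal_of_lt hp
  refine le_antisymm (le_iInf₂ fun u hu => ?_)
    (biInf_mono fun u hu => ⟨sobolevWZero_subset_sobolevWZeroMinus hΩ hΩb hp hu.1, hu.2⟩)
  obtain ⟨hu, hu0⟩ := hu
  obtain ⟨g, H⟩ := mem_sobolevW_iff.1 hu.1
  -- Over the empty set all classes coincide, which contradicts `u ≠ 0`; rescaling needs a point of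
  -- `Ω`.
  have hne : Ω.Nonempty := by
    rw [nonempty_iff_ne_empty]
    rintro rfl
    refine hu0 (AEEqFun.ext ?_)
    simp only [Measure.restrict_empty, ae_zero]
    exact Filter.eventually_bot
  have hcrit := H.memLp_criticalExponent hN hΩ hΩb hp hpN hu
  obtain ⟨C, hC, HC⟩ := exists_sobolev_isTest hN hp.le (inv_criticalExponent hp hpN)
    (zero_le_one.trans hq.le)
  obtain ⟨m1, m2⟩ := H.memLp_indicator hΩ
  have mc : MemLp (Ω.indicator u) (ENNReal.ofReal (criticalExponent N p)) volume :=
    (memLp_indicator_iff_restrict hΩ.measurableSet).2 hcrit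
  have hA := H.approxByTest_extend hΩ hΩb hp hu isOpen_univ (subset_univ _)
  obtain ⟨φ, hφ, t1, t2⟩ := hA.exists_seq
  have t3 : Tendsto (fun n => eLpNorm (φ n - Ω.indicator u)
      (ENNReal.ofReal (criticalExponent N p)) volume) atTop (𝓝 0) := by
    have hlim : Tendsto (fun n => C * eLpNorm (gradient (φ n) - Ω.indicator g)
        (ENNReal.ofReal p) volume) atTop (𝓝 (C * 0)) :=
      ENNReal.Tendsto.const_mul t2 (Or.inr hC)
    rw [mul_zero] at hlim
    refine tendsto_of_tendsto_of_tendsto_of_le_of_le tendsto_const_nhds hlim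
      (fun _ => zero_le) fun n => ?_
    have n1 := (hφ n).memLp (ENNReal.ofReal p) volume
    have n2 := (hφ n).memLp_gradient (ENNReal.ofReal p) volume
    -- The difference `φ n - u` is itself a limit of test functions, so the Sobolev inequality turns
    -- convergence of gradients into convergence in `L^{p^*}`.
    have hsub := ((hφ n).approxByTest (ENNReal.ofReal p)).add hp1 n1.1 n2.1
      (m1.1.const_smul (-1 : ℝ)) (m2.1.const_smul (-1 : ℝ)) (hA.const_smul (-1))
    simp only [neg_smul, one_smul, ← sub_eq_add_neg] at hsub
    exact hsub.eLpNorm_le hC hp1 (n1.sub m1) (n2.sub m2) HC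
  have l1 := tendsto_toReal_eLpNorm hq1 (fun n => (hφ n).memLp _ _) mc t3
  have l2 := tendsto_toReal_eLpNorm hp1 (fun n => (hφ n).memLp_gradient _ _) m2 t2
  rw [eLpNorm_indicator_eq_eLpNorm_restrict hΩ.measurableSet] at l1 l2
  have hpos : 0 < (eLpNorm u (ENNReal.ofReal (criticalExponent N p))
      (volume.restrict Ω)).toReal := by
    refine ENNReal.toReal_pos (fun h0 => hu0 ?_) hcrit.2.ne
    rw [eLpNorm_eq_zero_iff hcrit.1 (one_pos.trans_le hq1).ne'] at h0
    exact AEEqFun.ext (h0.trans AEEqFun.coeFn_zero.symm)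
  have l3 := (l2.div l1 hpos.ne').rpow_const (p := p) (Or.inr (zero_le_one.trans hp.le))
  rw [← H.sobolevQuotient_eq hΩ hp hpN hcrit] at l3
  refine ge_of_tendsto ((continuous_coe_real_ereal.tendsto _).comp l3) ?_
  -- For large `n` the norm of `φ n` in `L^{p^*}` is positive, which makes its rescaled copy an
  -- admissible nonzero competitor.
  filter_upwards [l1.eventually (lt_mem_nhds hpos)] with n hn
  obtain ⟨ψ, hψ, c, hc0, hct, e1, e2⟩ := (hφ n).exists_rescale hΩ hne hp hpN
  obtain ⟨hv, Hv⟩ := hψ.mk_mem_sobolevWZero hΩ hp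
  set v : MeasFun Ω := AEEqFun.mk ψ hψ.continuous.aestronglyMeasurable
  have hvae : v =ᵐ[volume.restrict Ω] ψ := AEEqFun.coeFn_mk _ _
  have e1' : eLpNorm v (ENNReal.ofReal (criticalExponent N p)) (volume.restrict Ω) =
      c * eLpNorm (φ n) (ENNReal.ofReal (criticalExponent N p)) volume := by
    rw [← e1, eLpNorm_congr_ae hvae, eLpNorm_restrict_eq_of_support_subset]
    exact (subset_tsupport ψ).trans hψ.tsupport_subset
  have e2' : eLpNorm (gradient ψ) (ENNReal.ofReal p) (volume.restrict Ω) =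
      c * eLpNorm (gradient (φ n)) (ENNReal.ofReal p) volume := by
    rw [← e2, eLpNorm_restrict_eq_of_support_subset]
    intro x hx
    by_contra h
    exact hx (hψ.gradient_eq_zero h)
  have hc : 0 < c.toReal := ENNReal.toReal_pos hc0 hct
  have hv0 : v ≠ 0 := by
    intro h0
    have : eLpNorm v (ENNReal.ofReal (criticalExponent N p)) (volume.restrict Ω) = 0 := by
      rw [h0, eLpNorm_congr_ae AEEqFun.coeFn_zero]
      simp
    rw [e1', mul_eq_zero, or_iff_right hc0] at this
    rw [this] at hn
    simp at hn
  refine (iInf₂_le v ⟨hv, hv0⟩).trans (le_of_eq ?_)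
  have hvm : MemLp v (ENNReal.ofReal (criticalExponent N p)) (volume.restrict Ω) :=
    (hψ.memLp _ _).ae_eq hvae.symm
  rw [Hv.sobolevQuotient_eq hΩ hp hpN hvm, e1', e2', ENNReal.toReal_mul, ENNReal.toReal_mul,
    mul_div_mul_left _ _ hc.ne']
  rfl

end sobolev

/-! ### Dominated convergence, smooth truncation and the chain rule -/

/-- Dominated convergence in `L^p`. -/
lemma tendsto_eLpNorm_zero_of_dominated {α F : Type*} [MeasurableSpace α] {μ : Measure α}
    [NormedAddCommGroup F] {p : ℝ≥0∞} (hp : 1 ≤ p) (hp' : p ≠ ⊤) {h : ℕ → α → F} {G : α → ℝ}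
    (mh : ∀ n, AEStronglyMeasurable (h n) μ) (hG : MemLp G p μ)
    (hle : ∀ n x, ‖h n x‖ ≤ G x) (hlim : ∀ᵐ x ∂μ, Tendsto (fun n => h n x) atTop (𝓝 0)) :
    Tendsto (fun n => eLpNorm (h n) p μ) atTop (𝓝 0) := by
  have hp0 : p ≠ 0 := (one_pos.trans_le hp).ne'
  have hpos : 0 < p.toReal := ENNReal.toReal_pos hp0 hp'
  simp_rw [eLpNorm_eq_lintegral_rpow_enorm_toReal hp0 hp']
  have h1 : Tendsto (fun n => ∫⁻ x, ‖h n x‖ₑ ^ p.toReal ∂μ) atTop (𝓝 (∫⁻ _, 0 ∂μ)) := by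
    refine tendsto_lintegral_of_dominated_convergence' (fun x => ‖G x‖ₑ ^ p.toReal)
      (fun n => (mh n).enorm.pow_const _) (fun n => Eventually.of_forall fun x => ?_) ?_ ?_
    · refine ENNReal.rpow_le_rpow ?_ hpos.le
      rw [← ofReal_norm, ← ofReal_norm]
      exact ENNReal.ofReal_le_ofReal ((hle n x).trans (le_abs_self _))
    · exact (lintegral_rpow_enorm_lt_top_of_eLpNorm_lt_top hp0 hp' hG.2).ne
    · filter_upwards [hlim] with x hx
      have h2 := (ENNReal.continuous_rpow_const (y := p.toReal)).tendsto 0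
      rw [ENNReal.zero_rpow_of_pos hpos] at h2
      have h3 : Tendsto (fun n => ‖h n x‖ₑ) atTop (𝓝 0) := by simpa using hx.enorm
      exact h2.comp h3
  rw [lintegral_zero] at h1
  have h2 := (ENNReal.continuous_rpow_const (y := 1 / p.toReal)).tendsto 0
  rw [ENNReal.zero_rpow_of_pos (by positivity)] at h2
  exact h2.comp h1

section truncation

/-- A smooth truncation of the identity that vanishes near zero. -/
noncomputable def smoothTrunc (t : ℝ) : ℝ :=
  t * (1 - (⟨1, 2, one_pos, one_lt_two⟩ : ContDiffBump (0 : ℝ)) t)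

lemma contDiff_smoothTrunc : ContDiff ℝ ∞ smoothTrunc :=
  contDiff_id.mul (contDiff_const.sub (ContDiffBump.contDiff _))

lemma smoothTrunc_eq_zero {t : ℝ} (ht : |t| ≤ 1) : smoothTrunc t = 0 := by
  rw [smoothTrunc, ContDiffBump.one_of_mem_closedBall, sub_self, mul_zero]
  simpa using ht

lemma smoothTrunc_eq_self {t : ℝ} (ht : 2 ≤ |t|) : smoothTrunc t = t := by
  rw [smoothTrunc, ContDiffBump.zero_of_le_dist, sub_zero, mul_one]
  simpa using ht

lemma abs_smoothTrunc_le (t : ℝ) : |smoothTrunc t| ≤ |t| := by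
  set b : ContDiffBump (0 : ℝ) := ⟨1, 2, one_pos, one_lt_two⟩
  rw [smoothTrunc, abs_mul]
  have h1 : 0 ≤ b t := b.nonneg
  have h2 : b t ≤ 1 := b.le_one
  have : |1 - b t| ≤ 1 := by rw [abs_le]; constructor <;> linarith
  exact mul_le_of_le_one_right (abs_nonneg t) this

lemma deriv_smoothTrunc_eq_one {t : ℝ} (ht : 2 < |t|) : deriv smoothTrunc t = 1 := by
  have : smoothTrunc =ᶠ[𝓝 t] id := by
    filter_upwards [(isOpen_lt continuous_const continuous_abs).mem_nhds ht] with s hs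
    exact smoothTrunc_eq_self hs.le
  rw [this.deriv_eq, deriv_id]

lemma deriv_smoothTrunc_zero : deriv smoothTrunc 0 = 0 := by
  have : smoothTrunc =ᶠ[𝓝 0] fun _ => 0 := by
    filter_upwards [(isOpen_lt continuous_abs continuous_const).mem_nhds
      (by simp : |(0 : ℝ)| < 1)] with s hs
    exact smoothTrunc_eq_zero hs.le
  rw [this.deriv_eq, deriv_const]

lemma exists_abs_deriv_smoothTrunc_le : ∃ M : ℝ, 0 ≤ M ∧ ∀ t, |deriv smoothTrunc t| ≤ M := by
  have hc : Continuous (deriv smoothTrunc) := contDiff_smoothTrunc.continuous_deriv (by simp)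
  obtain ⟨M, hM⟩ := (isCompact_Icc (a := (-2 : ℝ)) (b := 2)).exists_bound_of_continuousOn
    hc.continuousOn
  refine ⟨max M 1, by positivity, fun t => ?_⟩
  by_cases ht : |t| ≤ 2
  · exact (hM t (abs_le.1 ht)).trans (le_max_left _ _)
  · rw [deriv_smoothTrunc_eq_one (not_le.1 ht), abs_one]
    exact le_max_right _ _

end truncation

section chainRule

variable {N : ℕ} {p : ℝ≥0∞} {f : Eu N → ℝ} {g : Eu N → Eu N}

lemma gradient_comp_left {F : ℝ → ℝ} (hF : ContDiff ℝ 1 F) {φ : Eu N → ℝ}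
    (hφ : ContDiff ℝ 1 φ) :
    gradient (fun x => F (φ x)) = fun x => deriv F (φ x) • gradient φ x := by
  ext1 x
  have h1 := (hF.differentiable (by simp) (φ x)).hasDerivAt.comp_hasFDerivAt x
    (hφ.differentiable (by simp) x).hasFDerivAt
  rw [gradient, show (fun x => F (φ x)) = F ∘ φ from rfl, h1.fderiv, gradient]
  simp

/-- The chain rule in `W^{1,p}(ℝ^N)`. -/
lemma ApproxByTest.hasWeakGradient_comp {Ω : Set (Eu N)} (hp : 1 ≤ p) (hp' : p ≠ ⊤)
    (hf : MemLp f p volume) (hg : MemLp g p volume) (h : ApproxByTest Ω p f g)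
    {F : ℝ → ℝ} (hF : ContDiff ℝ 1 F) (hF0 : F 0 = 0) {M : ℝ} (hM : ∀ t, |deriv F t| ≤ M) :
    MemLp (fun x => F (f x)) p volume ∧ MemLp (fun x => deriv F (f x) • g x) p volume ∧
    HasWeakGradient univ (fun x => F (f x)) (fun x => deriv F (f x) • g x) := by
  have hM0 : 0 ≤ M := (abs_nonneg _).trans (hM 0)
  have hF'c : Continuous (deriv F) := hF.continuous_deriv (by simp)
  have hLip : ∀ a b, ‖F a - F b‖ ≤ M * ‖a - b‖ := fun a b =>
    Convex.norm_image_sub_le_of_norm_deriv_le (𝕜 := ℝ) (s := univ)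
      (fun x _ => hF.differentiable (by simp) x) (fun x _ => hM x) convex_univ (mem_univ _)
      (mem_univ _)
  have mF : ∀ {w : Eu N → ℝ}, AEStronglyMeasurable w volume →
      AEStronglyMeasurable (fun x => F (w x)) volume := fun hw =>
    hF.continuous.comp_aestronglyMeasurable hw
  have mF' : ∀ {w : Eu N → ℝ}, AEStronglyMeasurable w volume →
      AEStronglyMeasurable (fun x => deriv F (w x)) volume := fun hw =>
    hF'c.comp_aestronglyMeasurable hw
  have L1 : MemLp (fun x => F (f x)) p volume := by
    refine hf.of_le_mul (c := M) (mF hf.1) (Eventually.of_forall fun x => ?_)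
    simpa [hF0] using hLip (f x) 0
  have L2 : MemLp (fun x => deriv F (f x) • g x) p volume := by
    refine hg.of_le_mul (c := M) ((mF' hf.1).smul hg.1) (Eventually.of_forall fun x => ?_)
    rw [norm_smul]
    gcongr
    exact hM _
  refine ⟨L1, L2, ?_⟩
  obtain ⟨φ, hφ, t1, t2⟩ := h.exists_seq
  have hm := tendstoInMeasure_of_tendsto_eLpNorm (one_pos.trans_le hp).ne'
    (fun n => (hφ n).continuous.aestronglyMeasurable) hf.1 t1
  obtain ⟨ns, hns, hae⟩ := hm.exists_seq_tendsto_ae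
  have s1 : Tendsto (fun n => eLpNorm ((fun x => F (f x)) - fun x => F (φ (ns n) x)) p volume)
      atTop (𝓝 0) := by
    have hl := ENNReal.Tendsto.const_mul (a := ENNReal.ofReal M) (t1.comp hns.tendsto_atTop)
      (Or.inr ENNReal.ofReal_ne_top)
    rw [mul_zero] at hl
    refine tendsto_of_tendsto_of_tendsto_of_le_of_le tendsto_const_nhds hl
      (fun _ => zero_le) fun n => ?_
    refine (eLpNorm_le_mul_eLpNorm_of_ae_le_mul (g := φ (ns n) - f)
      (Eventually.of_forall fun x => ?_) p)
    rw [Pi.sub_apply, Pi.sub_apply, norm_sub_rev (φ (ns n) x)]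
    exact hLip _ _
  -- The error in the gradient splits in two. Here `deriv F` varies and `g` is fixed: convergence is
  -- only pointwise, and `2 M ‖g‖` dominates. The other part is at most `M` times the gradient error
  -- of `φ`.
  have s2 : Tendsto (fun n => eLpNorm (fun x => (deriv F (f x) - deriv F (φ (ns n) x)) • g x)
      p volume) atTop (𝓝 0) := by
    refine tendsto_eLpNorm_zero_of_dominated hp hp' (G := fun x => 2 * M * ‖g x‖) (fun n => ?_)
      (hg.norm.const_mul _) (fun n x => ?_) ?_
    · exact ((mF' hf.1).sub (mF' (hφ (ns n)).continuous.aestronglyMeasurable)).smul hg.1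
    · rw [norm_smul]
      gcongr
      have := norm_sub_le (deriv F (f x)) (deriv F (φ (ns n) x))
      have a1 := hM (f x)
      have a2 := hM (φ (ns n) x)
      rw [Real.norm_eq_abs, Real.norm_eq_abs, Real.norm_eq_abs] at this
      rw [Real.norm_eq_abs]
      linarith
    · filter_upwards [hae] with x hx
      have h1 : Tendsto (fun n => deriv F (f x) - deriv F (φ (ns n) x)) atTop
          (𝓝 (deriv F (f x) - deriv F (f x))) :=
        tendsto_const_nhds.sub ((hF'c.tendsto _).comp hx)
      rw [sub_self] at h1
      simpa using h1.smul_const (g x)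
  have s3 : Tendsto (fun n => ENNReal.ofReal M *
      eLpNorm (gradient (φ (ns n)) - g) p volume) atTop (𝓝 0) := by
    have hl := ENNReal.Tendsto.const_mul (a := ENNReal.ofReal M) (t2.comp hns.tendsto_atTop)
      (Or.inr ENNReal.ofReal_ne_top)
    rwa [mul_zero] at hl
  have s4 := s2.add s3
  rw [add_zero] at s4
  refine HasWeakGradient.of_approx hp (L1.restrict _) (L2.restrict _) fun ε hε => ?_
  obtain ⟨n, hn1, hn2⟩ := ((s1.eventually_le_const (pos_iff_ne_zero.2 hε)).and
    (s4.eventually_le_const (pos_iff_ne_zero.2 hε))).exists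
  have hC := hF.comp (hφ (ns n)).contDiff_one
  refine ⟨fun x => F (φ (ns n) x), fun x => deriv F (φ (ns n) x) • gradient (φ (ns n)) x,
    ?_, ?_, ?_, ?_, ?_⟩
  · rw [← gradient_comp_left hF (hφ (ns n)).contDiff_one]
    exact .of_contDiff hC
  · exact hC.continuous.aestronglyMeasurable
  · exact ((mF' (hφ (ns n)).continuous.aestronglyMeasurable).smul
      ((hφ (ns n)).memLp_gradient p _).1).restrict
  · rwa [Measure.restrict_univ]
  · rw [Measure.restrict_univ]
    refine le_trans ?_ hn2
    have e : ((fun x => deriv F (f x) • g x) -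
        fun x => deriv F (φ (ns n) x) • gradient (φ (ns n)) x) =
        (fun x => (deriv F (f x) - deriv F (φ (ns n) x)) • g x) +
        fun x => deriv F (φ (ns n) x) • (g x - gradient (φ (ns n)) x) := by
      ext1 x
      simp only [Pi.sub_apply, Pi.add_apply, sub_smul, smul_sub]
      abel
    rw [e]
    have mφ := mF' (hφ (ns n)).continuous.aestronglyMeasurable
    have mg := ((hφ (ns n)).memLp_gradient p volume).1
    refine (eLpNorm_add_le (((mF' hf.1).sub mφ).smul hg.1) (mφ.smul (hg.1.sub mg)) hp).trans ?_
    refine add_le_add le_rfl ?_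
    refine eLpNorm_le_mul_eLpNorm_of_ae_le_mul (c := M) (g := gradient (φ (ns n)) - g)
      (Eventually.of_forall fun x => ?_) p
    rw [Pi.smul_apply', norm_smul, Pi.sub_apply, Pi.sub_apply, norm_sub_rev]
    gcongr
    exact hM _

end chainRule

/-! ### Part (d): exponents above the dimension -/

section morrey

variable {N : ℕ} {Ω : Set (Eu N)} {p : ℝ≥0∞} {f : Eu N → ℝ} {g : Eu N → Eu N}

/-- For `p > N` the functions in `W_0^{1,p}(Ω)` are continuous and vanish outside `Ω`. -/
lemma ApproxByTest.exists_continuous (hN : 1 ≤ N) (hΩb : Bornology.IsBounded Ω) (hp : p ≠ ⊤)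
    (hpN : (N : ℝ) < p.toReal) (hf : AEStronglyMeasurable f volume)
    (hg : AEStronglyMeasurable g volume) (h : ApproxByTest Ω p f g) :
    ∃ f₀ : Eu N → ℝ, Continuous f₀ ∧ (∀ x ∉ Ω, f₀ x = 0) ∧ f₀ =ᵐ[volume] f := by
  have hN' : (1 : ℝ) ≤ N := by exact_mod_cast hN
  have hp1 : 1 ≤ p := by
    rw [← ENNReal.toReal_le_toReal (by simp) hp, ENNReal.toReal_one]
    linarith
  obtain ⟨R, hR, hΩR⟩ := hΩb.subset_closedBall_lt 0 0
  obtain ⟨C, hC, HC⟩ := exists_sup_bound_isTest hN hp hpN hR.le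
  obtain ⟨φ, hφ, t1, t2⟩ := h.exists_seq
  -- Morrey's bound for differences makes the approximants uniformly Cauchy. Their limit is
  -- continuous, and it vanishes off `Ω` at every point because they do.
  have hcau : UniformCauchySeqOn φ atTop univ := by
    rw [Metric.uniformCauchySeqOn_iff]
    intro r hr
    set ε := ENNReal.ofReal r
    have hε : 0 < ε := ENNReal.ofReal_pos.2 hr
    have hl := ENNReal.Tendsto.const_mul (a := C) t2 (Or.inr hC)
    rw [mul_zero] at hl
    obtain ⟨M, hM⟩ := eventually_atTop.1 (hl.eventually_lt_const (ENNReal.half_pos hε.ne'))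
    refine ⟨M, fun m hm n hn x _ => ?_⟩
    have hsub : IsTest (Metric.closedBall 0 R) (φ m - φ n) := by
      have := ((hφ m).add ((hφ n).const_smul (-1))).mono hΩR
      simpa [sub_eq_add_neg] using this
    have h1 := HC _ hsub x
    rw [gradient_sub (hφ m).differentiable (hφ n).differentiable,
      ← sub_sub_sub_cancel_right _ _ g] at h1
    rw [← ENNReal.ofReal_lt_ofReal_iff hr, ← edist_dist, edist_eq_enorm_sub]
    refine h1.trans_lt ?_
    have h2 := eLpNorm_sub_le (((hφ m).memLp_gradient p volume).1.sub hg)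
      (((hφ n).memLp_gradient p volume).1.sub hg) hp1
    calc _ ≤ C * (eLpNorm (gradient (φ m) - g) p volume +
          eLpNorm (gradient (φ n) - g) p volume) := by gcongr
      _ = C * eLpNorm (gradient (φ m) - g) p volume +
          C * eLpNorm (gradient (φ n) - g) p volume := mul_add _ _ _
      _ < ε / 2 + ε / 2 := ENNReal.add_lt_add (hM m hm) (hM n hn)
      _ = ε := ENNReal.add_halves ε
  have hpt : ∀ x, ∃ l, Tendsto (fun n => φ n x) atTop (𝓝 l) := fun x =>
    cauchySeq_tendsto_of_complete (hcau.cauchySeq (mem_univ x))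
  choose f₀ hf₀ using hpt
  have hunif : TendstoUniformly φ f₀ atTop := by
    rw [← tendstoUniformlyOn_univ]
    exact hcau.tendstoUniformlyOn_of_tendsto fun x _ => hf₀ x
  refine ⟨f₀, hunif.continuous (Frequently.of_forall fun n => (hφ n).continuous), fun x hx => ?_, ?_⟩
  · have h0 := hf₀ x
    simp_rw [fun n => (hφ n).eq_zero hx] at h0
    exact (tendsto_nhds_unique h0 tendsto_const_nhds)
  · have hm := tendstoInMeasure_of_tendsto_eLpNorm (one_pos.trans_le hp1).ne'
      (fun n => (hφ n).continuous.aestronglyMeasurable) hf t1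
    obtain ⟨ns, hns, hae⟩ := hm.exists_seq_tendsto_ae
    filter_upwards [hae] with x hx
    exact tendsto_nhds_unique ((hf₀ x).comp hns.tendsto_atTop) hx

/-- A continuous function in `W^{1,p}(ℝ^N)` that vanishes outside a bounded open set `Ω` is in
`W_0^{1,p}(Ω)`. -/
lemma HasWeakGradient.approxByTest_of_continuous (hΩ : IsOpen Ω) (hΩb : Bornology.IsBounded Ω)
    (hp : 1 ≤ p) (hp' : p ≠ ⊤) (hf : MemLp f p volume) (hg : MemLp g p volume)
    (h : HasWeakGradient univ f g) (hc : Continuous f) (hf0 : ∀ x ∉ Ω, f x = 0) :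
    ApproxByTest Ω p f g := by
  have hA : ApproxByTest univ p f g :=
    h.approxByTest isOpen_univ hΩb.isCompact_closure (subset_univ _) hp hp' hf hg
      fun x hx => hf0 x fun h => hx (subset_closure h)
  obtain ⟨M, hM0, hM⟩ := exists_abs_deriv_smoothTrunc_le
  -- `F n` kills values of size at most `1 / (n + 1)`, tends to the identity, and has the derivative
  -- bound of `smoothTrunc` for every `n`.
  let F : ℕ → ℝ → ℝ := fun n t => ((n : ℝ) + 1)⁻¹ * smoothTrunc (((n : ℝ) + 1) * t)
  have hn0 : ∀ n : ℕ, (0 : ℝ) < (n : ℝ) + 1 := fun n => by positivity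
  have hS1 : ContDiff ℝ 1 smoothTrunc := contDiff_smoothTrunc.of_le (by simp)
  have hFd : ∀ n, ContDiff ℝ 1 (F n) := fun n =>
    contDiff_const.mul (hS1.comp (contDiff_const.mul contDiff_id))
  have hFder : ∀ n t, deriv (F n) t = deriv smoothTrunc (((n : ℝ) + 1) * t) := by
    intro n t
    have h1 : HasDerivAt (fun t : ℝ => ((n : ℝ) + 1) * t) ((n : ℝ) + 1) t := by
      simpa using (hasDerivAt_id t).const_mul ((n : ℝ) + 1)
    have h2 : HasDerivAt (F n) _ t :=
      ((hS1.differentiable (by simp) _).hasDerivAt.comp t h1).const_mul ((n : ℝ) + 1)⁻¹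
    rw [h2.deriv]
    field_simp [(hn0 n).ne']
  have hF0 : ∀ n, F n 0 = 0 := fun n => by simp [F, smoothTrunc]
  have hFle : ∀ n t, |F n t| ≤ |t| := by
    intro n t
    have h1 := abs_smoothTrunc_le (((n : ℝ) + 1) * t)
    simp only [F]
    rw [abs_mul, abs_of_pos (inv_pos.2 (hn0 n)), inv_mul_le_iff₀ (hn0 n)]
    rwa [abs_mul, abs_of_pos (hn0 n)] at h1
  have hbig : ∀ t : ℝ, t ≠ 0 → ∀ᶠ n : ℕ in atTop, 2 < |((n : ℝ) + 1) * t| := by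
    intro t ht
    have h1 : Tendsto (fun n : ℕ => ((n : ℝ) + 1) * |t|) atTop atTop :=
      (tendsto_atTop_add_const_right _ 1 tendsto_natCast_atTop_atTop).atTop_mul_const
        (abs_pos.2 ht)
    filter_upwards [h1.eventually_gt_atTop 2] with n hn
    rwa [abs_mul, abs_of_pos (hn0 n)]
  have chain := fun n => hA.hasWeakGradient_comp hp hp' hf hg (hFd n) (hF0 n) (M := M)
    fun t => by rw [hFder]; exact hM _
  classical
  -- The truncated gradients converge to `g` with its values on `{f = 0}` replaced by `0`, as `deriv
  -- (F n) 0 = 0`.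
  let g' : Eu N → Eu N := fun x => if f x = 0 then 0 else g x
  have hset : MeasurableSet {x | f x = 0} := (isClosed_singleton.preimage hc).measurableSet
  have mg' : AEStronglyMeasurable g' volume :=
    AEStronglyMeasurable.piecewise hset aestronglyMeasurable_const hg.1.restrict
  have hg'le : ∀ x, ‖g' x‖ ≤ ‖g x‖ := by
    intro x
    by_cases hx : f x = 0 <;> simp [g', hx]
  have s1 : Tendsto (fun n => eLpNorm (f - fun x => F n (f x)) p volume) atTop (𝓝 0) := by
    refine tendsto_eLpNorm_zero_of_dominated hp hp' (G := fun x => 2 * ‖f x‖) (fun n => ?_)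
      (hf.norm.const_mul _) (fun n x => ?_) (Eventually.of_forall fun x => ?_)
    · exact hf.1.sub (chain n).1.1
    · have := norm_sub_le (f x) (F n (f x))
      have h2 := hFle n (f x)
      rw [Pi.sub_apply]
      simp only [Real.norm_eq_abs] at this ⊢
      linarith
    · by_cases hx : f x = 0
      · simp [hx, hF0]
      · refine tendsto_const_nhds.congr' ?_
        filter_upwards [hbig _ hx] with n hn
        simp only [Pi.sub_apply, F]
        rw [smoothTrunc_eq_self hn.le, inv_mul_cancel_left₀ (hn0 n).ne', sub_self]
  have s2 : Tendsto (fun n => eLpNorm (g' - fun x => deriv (F n) (f x) • g x) p volume) atTop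
      (𝓝 0) := by
    refine tendsto_eLpNorm_zero_of_dominated hp hp' (G := fun x => (1 + M) * ‖g x‖) (fun n => ?_)
      (hg.norm.const_mul _) (fun n x => ?_) (Eventually.of_forall fun x => ?_)
    · exact mg'.sub (chain n).2.1.1
    · rw [Pi.sub_apply, add_mul, one_mul]
      refine (norm_sub_le _ _).trans (add_le_add (hg'le x) ?_)
      rw [norm_smul, hFder]
      gcongr
      exact hM _
    · by_cases hx : f x = 0
      · simp [g', hx, hFder, deriv_smoothTrunc_zero]
      · refine tendsto_const_nhds.congr' ?_
        filter_upwards [hbig _ hx] with n hn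
        simp [g', hx, hFder, deriv_smoothTrunc_eq_one hn]
  have both : ∀ ε : ℝ≥0∞, ε ≠ 0 → ∃ n, eLpNorm (f - fun x => F n (f x)) p volume ≤ ε ∧
      eLpNorm (g' - fun x => deriv (F n) (f x) • g x) p volume ≤ ε := fun ε hε =>
    ((s1.eventually_le_const (pos_iff_ne_zero.2 hε)).and
      (s2.eventually_le_const (pos_iff_ne_zero.2 hε))).exists
  have hw : HasWeakGradient univ f g' := by
    refine HasWeakGradient.of_approx hp (hf.restrict _)
      ((hg.of_le mg' (Eventually.of_forall hg'le)).restrict _) fun ε hε => ?_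
    obtain ⟨n, e1, e2⟩ := both ε hε
    refine ⟨_, _, (chain n).2.2, (chain n).1.1.restrict, (chain n).2.1.1.restrict, ?_, ?_⟩ <;>
      rwa [Measure.restrict_univ]
  -- Uniqueness of weak gradients shows that `g` vanishes almost everywhere on `{f = 0}`.
  have hgg' : g' =ᵐ[volume] g := by
    simpa using hw.ae_unique isOpen_univ h
  refine ApproxByTest.congr_ae ?_ (ae_eq_refl f) hgg'
  refine ApproxByTest.of_approx hp hf.1 mg' fun ε hε => ?_
  obtain ⟨n, e1, e2⟩ := both ε hε
  refine ⟨_, _, (chain n).1.1, (chain n).2.1.1, ?_, e1, e2⟩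
  -- Continuity makes this superlevel set closed, and the vanishing of `f` off the bounded set `Ω`
  -- makes it a compact subset of `Ω`. It carries the truncated function.
  set K : Set (Eu N) := {x | ((n : ℝ) + 1)⁻¹ ≤ |f x|} with hK
  have hKΩ : K ⊆ Ω := by
    intro x hx
    by_contra h
    have := inv_pos.2 (hn0 n)
    simp only [hK, mem_ofPred_eq, hf0 x h, abs_zero] at hx
    linarith
  have hKc : IsCompact K := by
    refine Metric.isCompact_of_isClosed_isBounded ?_ (hΩb.subset hKΩ)
    exact isClosed_le continuous_const hc.abs
  refine (chain n).2.2.approxByTest hΩ hKc hKΩ hp hp' (chain n).1 (chain n).2.1 fun x hx => ?_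
  have h1 : |((n : ℝ) + 1) * f x| ≤ 1 := by
    have h2 : |f x| < ((n : ℝ) + 1)⁻¹ := not_le.1 hx
    rw [abs_mul, abs_of_pos (hn0 n)]
    have := mul_le_mul_of_nonneg_left h2.le (hn0 n).le
    rwa [mul_inv_cancel₀ (hn0 n).ne'] at this
  simp [F, smoothTrunc_eq_zero h1]

lemma sobolevWZeroMinus_eq_of_lt (hN : 1 ≤ N) (hΩ : IsOpen Ω) (hΩb : Bornology.IsBounded Ω)
    {p : ℝ} (hp : 1 < p) (hpN : N < p) : SobolevWZeroMinus Ω p = SobolevWZero Ω p := by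
  refine Subset.antisymm (fun u hu => ?_) (sobolevWZero_subset_sobolevWZeroMinus hΩ hΩb hp)
  obtain ⟨g, H⟩ := mem_sobolevW_iff.1 hu.1
  have hN' : (1 : ℝ) ≤ N := by exact_mod_cast hN
  -- An exponent strictly between `N` and `p`: below `p` to have approximation from inside `Ω`,
  -- above `N` for Morrey's bound.
  have hs : ((N : ℝ) + p) / 2 ∈ Ioo 1 p := ⟨by linarith, by linarith⟩
  obtain ⟨m1, m2⟩ := H.memLp_indicator hΩ
  have hA := (H.mem_sobolevWZeroMinus_iff hΩ hΩb).1 hu _ hs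
  obtain ⟨f₀, hc, h0, hae⟩ := hA.exists_continuous hN hΩb ENNReal.ofReal_ne_top
    (by rw [toReal_ofReal_of_lt hs.1]; linarith) m1.1 m2.1
  have hw := (H.extend hΩ hΩb hp hu).hasWeakGradient.congr_ae
    (ae_restrict_of_ae hae.symm) (ae_eq_refl _)
  exact (H.mem_sobolevWZero_iff hΩ hp).2 ((hw.approxByTest_of_continuous hΩ hΩb
    (one_le_ofReal_of_lt hp) ENNReal.ofReal_ne_top (m1.ae_eq hae.symm) m2 hc h0).congr_ae hae
    (ae_eq_refl _))

end morrey

/-! ### Part (e): the segment property -/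

section segment

variable {N : ℕ} {Ω : Set (Eu N)} {p : ℝ≥0∞} {f : Eu N → ℝ} {g : Eu N → Eu N}

/-- If small translations of `f` have compact support in `Ω`, then `f` is in `W_0^{1,p}(Ω)`. -/
lemma HasWeakGradient.approxByTest_of_translate (hΩ : IsOpen Ω) {K : Set (Eu N)}
    (hK : IsCompact K) {y : Eu N} (hy : ∀ z ∈ K, ∀ t ∈ Ioo (0 : ℝ) 1, z + t • y ∈ Ω)
    (hp : 1 ≤ p) (hp' : p ≠ ⊤) (hf : MemLp f p volume) (hg : MemLp g p volume)
    (h : HasWeakGradient univ f g) (hfK : ∀ x ∉ K, f x = 0) : ApproxByTest Ω p f g := by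
  refine ApproxByTest.of_approx hp hf.1 hg.1 fun ε hε => ?_
  have ht : Tendsto (fun t : ℝ => t • y) (𝓝[>] 0) (𝓝 0) := by
    have : Tendsto (fun t : ℝ => t • y) (𝓝 0) (𝓝 ((0 : ℝ) • y)) :=
      (continuous_id.smul continuous_const).tendsto 0
    rw [zero_smul] at this
    exact this.mono_left nhdsWithin_le_nhds
  have e1 := ((tendsto_eLpNorm_translate_sub hp hp' hf).comp ht).eventually_le_const
    (pos_iff_ne_zero.2 hε)
  have e2 := ((tendsto_eLpNorm_translate_sub hp hp' hg).comp ht).eventually_le_const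
    (pos_iff_ne_zero.2 hε)
  obtain ⟨t, ⟨h1, h2⟩, ht01⟩ := ((e1.and e2).and (Ioo_mem_nhdsGT (zero_lt_one' ℝ))).exists
  have mp := measurePreserving_sub_right (volume : Measure (Eu N)) (t • y)
  have L1 : MemLp (fun x => f (x - t • y)) p volume := hf.comp_measurePreserving mp
  have L2 : MemLp (fun x => g (x - t • y)) p volume := hg.comp_measurePreserving mp
  refine ⟨_, _, L1.1, L2.1, ?_, ?_, ?_⟩
  · refine (h.comp_sub_right (t • y)).approxByTest (K := (fun x => x + t • y) '' K) hΩ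
      (hK.image (by fun_prop)) ?_ hp hp' L1 L2 fun x hx => hfK _ fun hxK => hx ?_
    · rintro _ ⟨z, hz, rfl⟩
      exact hy z hz t ht01
    · exact ⟨_, hxK, by simp⟩
  · rw [eLpNorm_sub_comm]
    exact h1
  · rw [eLpNorm_sub_comm]
    exact h2

open scoped Manifold in
lemma exists_isTest_partition {ι : Type*} [Fintype ι] {K : Set (Eu N)} (hK : IsClosed K)
    {U : ι → Set (Eu N)} (hU : ∀ i, IsOpen (U i)) (hUb : ∀ i, Bornology.IsBounded (U i))
    (hKU : K ⊆ ⋃ i, U i) :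
    ∃ χ : ι → Eu N → ℝ, (∀ i, IsTest (U i) (χ i)) ∧ ∀ x ∈ K, ∑ i, χ i x = 1 := by
  obtain ⟨χ, hχ⟩ := SmoothPartitionOfUnity.exists_isSubordinate 𝓘(ℝ, Eu N) hK U hU hKU
  refine ⟨fun i => χ i, fun i => ⟨(χ i).contMDiff.contDiff, ?_, hχ i⟩, fun x hx => ?_⟩
  · exact Metric.isCompact_of_isClosed_isBounded (isClosed_tsupport _) ((hUb i).subset (hχ i))
  · rw [← finsum_eq_sum_of_fintype]
    exact χ.sum_eq_one hx

/-- Puts interior and boundary points on the same footing: at interior points `Ω` itself and `y = 0`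
serve, and at boundary points a unit ball makes the neighbourhood bounded. -/
lemma SegmentProperty.exists_nhds (hΩ : IsOpen Ω) (hΩb : Bornology.IsBounded Ω)
    (hseg : SegmentProperty Ω) {x : Eu N} (hx : x ∈ closure Ω) :
    ∃ U : Set (Eu N), IsOpen U ∧ Bornology.IsBounded U ∧ x ∈ U ∧ ∃ y : Eu N,
      ∀ z ∈ closure Ω ∩ U, ∀ t ∈ Ioo (0 : ℝ) 1, z + t • y ∈ Ω := by
  by_cases hxΩ : x ∈ Ω
  · exact ⟨Ω, hΩ, hΩb, hxΩ, 0, fun z hz t _ => by simpa using hz.2⟩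
  · have hfr : x ∈ frontier Ω := by
      rw [hΩ.frontier_eq]
      exact ⟨hx, hxΩ⟩
    obtain ⟨U, hU, hxU, y, -, hy⟩ := hseg x hfr
    exact ⟨U ∩ Metric.ball x 1, hU.inter Metric.isOpen_ball,
      Metric.isBounded_ball.subset inter_subset_right, ⟨hxU, Metric.mem_ball_self one_pos⟩, y,
      fun z hz => hy z ⟨hz.1, hz.2.1⟩⟩

/-- If `Ω` has the segment property, then the functions in `W^{1,p}(ℝ^N)` that vanish outside `Ω`
are in `W_0^{1,p}(Ω)`. -/
lemma HasWeakGradient.approxByTest_of_segmentProperty (hΩ : IsOpen Ω)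
    (hΩb : Bornology.IsBounded Ω) (hseg : SegmentProperty Ω) (hp : 1 ≤ p) (hp' : p ≠ ⊤)
    (hf : MemLp f p volume) (hg : MemLp g p volume) (h : HasWeakGradient univ f g)
    (hf0 : ∀ x ∉ Ω, f x = 0) : ApproxByTest Ω p f g := by
  choose! U hUo hUb hxU y hy using fun (x : Eu N) (hx : x ∈ closure Ω) =>
    hseg.exists_nhds hΩ hΩb hx
  obtain ⟨T, hTΩ, hT⟩ := hΩb.isCompact_closure.elim_nhds_subcover U
    fun x hx => (hUo x hx).mem_nhds (hxU x hx)
  have hcov : closure Ω ⊆ ⋃ i : T, U i := by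
    intro x hx
    obtain ⟨i, hi, hxi⟩ := mem_iUnion₂.1 (hT hx)
    exact mem_iUnion.2 ⟨⟨i, hi⟩, hxi⟩
  obtain ⟨χ, hχ, hsum⟩ := exists_isTest_partition isClosed_closure
    (fun i : T => hUo i (hTΩ i i.2)) (fun i : T => hUb i (hTΩ i i.2)) hcov
  have L1 : ∀ i, MemLp (fun x => χ i x * f x) p volume := fun i =>
    hf.smul ((hχ i).memLp ⊤ volume)
  have L2 : ∀ i, MemLp (fun x => χ i x • g x + f x • gradient (χ i) x) p volume := fun i =>
    (hg.smul ((hχ i).memLp ⊤ volume)).add (((hχ i).memLp_gradient ⊤ volume).smul hf)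
  have hA : ∀ i, ApproxByTest Ω p (fun x => χ i x * f x)
      (fun x => χ i x • g x + f x • gradient (χ i) x) := by
    intro i
    -- The piece `χ i * f` is carried by a compact part of `closure Ω ∩ U i`, where the single
    -- direction `y i` points into `Ω`.
    refine (h.smul_smooth (hχ i).contDiff isOpen_univ).approxByTest_of_translate hΩ
      (K := closure Ω ∩ tsupport (χ i)) (y := y i)
      (hΩb.isCompact_closure.inter_right (isClosed_tsupport _)) ?_ hp hp' (L1 i) (L2 i) ?_
    · exact fun z hz => hy i (hTΩ i i.2) z ⟨hz.1, (hχ i).tsupport_subset hz.2⟩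
    · intro x hx
      by_cases hxΩ : x ∈ Ω
      · have : x ∉ tsupport (χ i) := fun h' => hx ⟨subset_closure hxΩ, h'⟩
        rw [image_eq_zero_of_notMem_tsupport this, zero_mul]
      · rw [hf0 x hxΩ, mul_zero]
  have hS := ApproxByTest.sum hp Finset.univ (fun i _ => (L1 i).1) (fun i _ => (L2 i).1)
    fun i _ => hA i
  have hfs : (∑ i : T, fun x => χ i x * f x) = f := by
    ext x
    rw [Finset.sum_apply, ← Finset.sum_mul]
    by_cases hx : x ∈ Ω
    · rw [hsum x (subset_closure hx), one_mul]
    · rw [hf0 x hx, mul_zero]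
  rw [hfs] at hS
  -- The terms with `gradient (χ i)` need not be cancelled by hand: the sum is a weak gradient of
  -- `f`, hence equal to `g` almost everywhere.
  have hw := hS.hasWeakGradient hp hf (memLp_finsetSum' _ fun i _ => L2 i)
  refine hS.congr_ae (ae_eq_refl _) ?_
  simpa using hw.ae_unique isOpen_univ h

lemma sobolevWZeroMinus_eq_of_segmentProperty (hΩ : IsOpen Ω) (hΩb : Bornology.IsBounded Ω)
    {p : ℝ} (hp : 1 < p) (hseg : SegmentProperty Ω) :
    SobolevWZeroMinus Ω p = SobolevWZero Ω p := by
  refine Subset.antisymm (fun u hu => ?_) (sobolevWZero_subset_sobolevWZeroMinus hΩ hΩb hp)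
  obtain ⟨g, H⟩ := mem_sobolevW_iff.1 hu.1
  obtain ⟨m1, m2⟩ := H.memLp_indicator hΩ
  exact (H.mem_sobolevWZero_iff hΩ hp).2
    ((H.extend hΩ hΩb hp hu).hasWeakGradient.approxByTest_of_segmentProperty hΩ hΩb hseg
      (one_le_ofReal_of_lt hp) ENNReal.ofReal_ne_top m1 m2 fun x hx => indicator_of_notMem hx _)

end segment

theorem proposition2p1 {N : ℕ} (hN : 1 ≤ N) (Ω : Set (EuclideanSpace ℝ (Fin N)))
    (hΩ : IsOpen Ω) (hΩb : Bornology.IsBounded Ω) (p : ℝ) (hp : 1 < p) :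
    -- (a) a closed vector subspace of `W^{1,p}(Ω)` that contains `W^{1,p}_0(Ω)`
    ((∃ V : Submodule ℝ (MeasFun Ω), (V : Set (MeasFun Ω)) = SobolevWZeroMinus Ω p) ∧
      SobolevWZeroMinus Ω p ⊆ SobolevW Ω p ∧
      sobolevClosure Ω p (SobolevWZeroMinus Ω p) ⊆ SobolevWZeroMinus Ω p ∧
      SobolevWZero Ω p ⊆ SobolevWZeroMinus Ω p) ∧
    -- (b) extension by zero, and the gradient norm
    ((∀ u ∈ SobolevWZeroMinus Ω p, MemSobolev univ p (Ω.indicator u)) ∧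
      IsNormOn (SobolevWZeroMinus Ω p) (gradNorm Ω p) ∧
      ∃ c > 0, ∃ C > 0, ∀ u ∈ SobolevWZeroMinus Ω p,
        c * sobolevNorm Ω p u ≤ gradNorm Ω p u ∧ gradNorm Ω p u ≤ C * sobolevNorm Ω p u) ∧
    -- (c) the best Sobolev constant; infima in the extended reals
    (p < N →
      (∀ u ∈ SobolevWZeroMinus Ω p,
        MemLp u (ENNReal.ofReal (criticalExponent N p)) (volume.restrict Ω)) ∧
      (⨅ u ∈ SobolevWZero Ω p \ {0}, (sobolevQuotient Ω p u : EReal)) =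
        (⨅ u ∈ SobolevWZeroMinus Ω p \ {0}, (sobolevQuotient Ω p u : EReal))) ∧
    -- (d)
    (N < p → SobolevWZeroMinus Ω p = SobolevWZero Ω p) ∧
    -- (e)
    (SegmentProperty Ω → SobolevWZeroMinus Ω p = SobolevWZero Ω p) := by
  refine ⟨⟨⟨sobolevWZeroMinusSubmodule hΩ hΩb p, rfl⟩, sobolevWZeroMinus_subset,
    sobolevClosure_sobolevWZeroMinus_subset hΩ hΩb hp,
    sobolevWZero_subset_sobolevWZeroMinus hΩ hΩb hp⟩,
    ⟨fun u hu => ?_, isNormOn_gradNorm hN hΩ hΩb hp, exists_gradNorm_equiv hN hΩ hΩb hp⟩,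
    fun hpN => ⟨fun u hu => ?_, iInf_sobolevQuotient_eq hN hΩ hΩb hp hpN⟩,
    sobolevWZeroMinus_eq_of_lt hN hΩ hΩb hp, sobolevWZeroMinus_eq_of_segmentProperty hΩ hΩb hp⟩
  · obtain ⟨g, H⟩ := mem_sobolevW_iff.1 hu.1
    have H' := H.extend hΩ hΩb hp hu
    exact ⟨H'.memLp, _, H'.hasWeakGradient, H'.memLp_grad⟩
  · obtain ⟨g, H⟩ := mem_sobolevW_iff.1 hu.1
    exact H.memLp_criticalExponent hN hΩ hΩb hp hpN hu
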